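/- **Setting.** Let $\lambda\in\mathbb N$ be the security parameter, $N=N(\lambda)\le\mathrm{poly}(\lambda)$, $n=n(\lambda)$ even with $n=\Omega(\lambda)$, $t=t(\lambda)=\Theta(\sqrt n)$ and $C=\lfloor n/(4t)\rfloor$. For $A\le\mathbb Z_2^n$ let $A^\perp=\{x:\langle x,a\rangle=0\ \forall a\in A\}$ and let $O_A(x)=\mathbb 1_{x\in A}$. A master secret key is $msk=(A,(v_i)_{i\in[n/2]},(w_j)_{j\in[n/2]},(I_{id},J_{id})_{id\in[N]})\leftarrow\mathsf{Setup}(1^\lambda)$, where $A\le\mathbb Z_2^n$ is uniform with $\dim A=\dim A^\perp=n/2$, the $v_i\in A$ and $w_j\in A^\perp$ are uniform and independent, and each $I_{id}$ and each $J_{id}$ is the set of $t$ independent uniform samples from $[n/2]$ (the samples are listed in $msk$). Put $I_{adv}=\bigcup_{id>N-C}I_{id}$, $J_{adv}=\bigcup_{id>N-C}J_{id}$, $V_{id}=\mathrm{span}\{v_i\}_{i\in I_{id}}$, $W_{id}=\mathrm{span}\{w_j\}_{j\in J_{id}}$, $V_{adv}=\mathrm{span}\{v_i\}_{i\in I_{adv}}$,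 $W_{adv}=\mathrm{span}\{w_j\}_{j\in J_{adv}}$. Call $msk$ *good* if for every $id\in[N-C]$ $$\dim(V_{adv}+V_{id})\ge\dim V_{adv}+t/4\quad\text{and}\quad\dim(W_{adv}+W_{id})\ge\dim W_{adv}+t/4 .$$ Let $\mathcal M(A)$ be the set of invertible $M\in\mathbb Z_2^{n\times n}$ with $M^TA\subseteq A$ and $M^TA^\perp\subseteq A^\perp$. For $M\in\mathcal M(A)$ let $M(msk)$ be $msk$ with $v_i$ replaced by $Mv_i$ for $i\notin I_{adv}$ and $w_j$ replaced by $Mw_j$ for $j\notin J_{adv}$. For $id\in[N-C]$, $s\in\{0,1\}$, $x\in\mathbb Z_2^n$, the full oracle $O_{Full}[A](id,s,x)$ is $O_A(x)$ if $s=0$ and $O_{A^\perp}(x)$ if $s=1$; the franchised oracle $O_{Fran}[msk](id,s,x)$ is $O_{W_{id}^\perp}(x)$ if $s=0$ and $O_{V_{id}^\perp}(x)$ if $s=1$. In the distinguishing game on $msk$, which the adversary $\mathcal A$ is given, $b\in\{0,1\}$ and $M\in\mathcal M(A)$ are uniform, $\mathcal A$ makes quantum queries to $O_{Full}[A]$ if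 $b=0$ and to $O_{Fran}[M(msk)]$ if $b=1$, and outputs a bit. Its advantage is $$\mathrm{Adv}_{\mathcal A}(msk)=\bigl|P[\mathcal A=1\mid b=0]-P[\mathcal A=1\mid b=1]\bigr|,$$ the probabilities being over $M$ and the randomness of $\mathcal A$. A polynomial-time quantum adversary is a family of quantum circuits with oracle gates, over a fixed finite set of unitary gates and of size at most a polynomial in $\lambda$; the circuit and its classical input may depend on $\lambda$ and $msk$. A function $f(\lambda)$ is negligible if $f(\lambda)=o(\lambda^{-c})$ for every $c$, and a probability $p$ is overwhelming if $1-p$ is negligible. **Theorem.** 1. $msk\leftarrow\mathsf{Setup}(1^\lambda)$ is good with overwhelming probability. Moreover, for every constant $\rho>0$, with overwhelming probability $msk$ is good and $\dim(A\cap A^\perp)\le\rho t$. 2. For every polynomial-time quantum adversary $\mathcal A$ and all constants $\rho\in(0,1/4)$ and $c>0$, for all sufficiently large $\lambda$ and every $msk$ in the support of $\mathsf{Setup}(1^\lambda)$ that is good and satisfies $\dim(A\cap A^\perp)\le\rho t$, $$\mathrm{Adv}_{\mathcal A}(msk)\le 2^{-c\,n^{1/3}} .$$ 3. For every polynomial-time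 quantum adversary $\mathcal A$, the expectation $\mathbb E_{msk\leftarrow\mathsf{Setup}(1^\lambda)}[\mathrm{Adv}_{\mathcal A}(msk)]$ is negligible in $\lambda$. -/

import Mathlib

open Asymptotics Filter

noncomputable section

namespace FranchisedMoney

/-! ### Linear algebra over the field with two elements -/

/-- The ambient space `ℤ₂ⁿ`. -/
abbrev Vec (n : ℕ) : Type := Fin n → ZMod 2

/-- The orthogonal complement `A^⊥ = {x | ∀ a ∈ A, ⟨x, a⟩ = 0}`. -/
def perp {n : ℕ} (A : Submodule (ZMod 2) (Vec n)) : Submodule (ZMod 2) (Vec n) where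
  carrier := {x | ∀ a ∈ A, x ⬝ᵥ a = 0}
  zero_mem' := by
    intro a _
    simp
  add_mem' := by
    intro x y hx hy a ha
    simp [add_dotProduct, hx a ha, hy a ha]
  smul_mem' := by
    intro c x hx a ha
    simp [smul_dotProduct, hx a ha]

open Classical in
/-- The membership oracle `O_A : ℤ₂ⁿ → {0, 1}`. -/
def memberOracle {n : ℕ} (A : Submodule (ZMod 2) (Vec n)) (x : Vec n) : Bool :=
  decide (x ∈ A)

open Classical in
/-- `𝓜(A)`: the invertible matrices `M` such that `Mᵀ` maps `A` into `A` and `A^⊥` into `A^⊥`. -/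
def preservingMatrices {n : ℕ} (A : Submodule (ZMod 2) (Vec n)) :
    Finset (Matrix (Fin n) (Fin n) (ZMod 2)) :=
  Finset.univ.filter fun M =>
    IsUnit M ∧ (∀ x ∈ A, Matrix.mulVec M.transpose x ∈ A) ∧
      ∀ x ∈ perp A, Matrix.mulVec M.transpose x ∈ perp A

/-! ### Master secret keys of the simple construction -/

/-- The collusion bound `C = n / (4 t)` (rounded down). -/
def collusionBound (n t : ℕ) : ℕ := n / (4 * t)

/-- The number `N - C` of honest verifiers. -/
def honestCount (N n t : ℕ) : ℕ := N - collusionBound n t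

/-- The data of a master secret key. `idxV id` and `idxW id` list the `t` indices sampled for the
sets `I_id` and `J_id`; repetitions are allowed. -/
@[ext]
structure MSK (N n t : ℕ) where
  A : Submodule (ZMod 2) (Vec n)
  v : Fin (n / 2) → Vec n
  w : Fin (n / 2) → Vec n
  idxV : Fin N → Fin t → Fin (n / 2)
  idxW : Fin N → Fin t → Fin (n / 2)

namespace MSK

variable {N n t : ℕ}

instance : Finite (MSK N n t) :=
  Finite.of_injective
    (fun k : MSK N n t => ((k.A : Set (Vec n)), k.v, k.w, k.idxV, k.idxW))
    (by
      intro a b h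
      simp only [Prod.mk.injEq, SetLike.coe_set_eq] at h
      exact MSK.ext h.1 h.2.1 h.2.2.1 h.2.2.2.1 h.2.2.2.2)

instance : Fintype (MSK N n t) := Fintype.ofFinite _

/-- The possible outputs of `Setup`: `dim A = dim A^⊥ = n / 2`, every `v_i` lies in `A` and every
`w_j` lies in `A^⊥`. -/
def Valid (k : MSK N n t) : Prop :=
  Module.finrank (ZMod 2) k.A = n / 2 ∧ Module.finrank (ZMod 2) (perp k.A) = n / 2 ∧
    (∀ i, k.v i ∈ k.A) ∧ ∀ j, k.w j ∈ perp k.A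

/-- The index set `I_id`. -/
def I (k : MSK N n t) (id : Fin N) : Set (Fin (n / 2)) := Set.range (k.idxV id)

/-- The index set `J_id`. -/
def J (k : MSK N n t) (id : Fin N) : Set (Fin (n / 2)) := Set.range (k.idxW id)

/-- `I_adv`, the union of the `I_id` over the last `C` identities. -/
def Iadv (k : MSK N n t) : Set (Fin (n / 2)) :=
  {i | ∃ id : Fin N, honestCount N n t ≤ id.val ∧ i ∈ k.I id}

/-- `J_adv`, the union of the `J_id` over the last `C` identities. -/
def Jadv (k : MSK N n t) : Set (Fin (n / 2)) :=
  {j | ∃ id : Fin N, honestCount N n t ≤ id.val ∧ j ∈ k.J id}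

/-- The subspace `V_id` spanned by the `v_i` with `i ∈ I_id`. -/
def V (k : MSK N n t) (id : Fin N) : Submodule (ZMod 2) (Vec n) :=
  Submodule.span (ZMod 2) (k.v '' k.I id)

/-- The subspace `W_id` spanned by the `w_j` with `j ∈ J_id`. -/
def W (k : MSK N n t) (id : Fin N) : Submodule (ZMod 2) (Vec n) :=
  Submodule.span (ZMod 2) (k.w '' k.J id)

/-- The subspace `V_adv`. -/
def Vadv (k : MSK N n t) : Submodule (ZMod 2) (Vec n) :=
  Submodule.span (ZMod 2) (k.v '' k.Iadv)

/-- The subspace `W_adv`. -/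
def Wadv (k : MSK N n t) : Submodule (ZMod 2) (Vec n) :=
  Submodule.span (ZMod 2) (k.w '' k.Jadv)

/-- The honest identity `id ∈ [N - C]` as an element of `[N]`. -/
def honest (id : Fin (honestCount N n t)) : Fin N :=
  Fin.castLE (Nat.sub_le N (collusionBound n t)) id

open Classical in
/-- The key `M(msk)`: `M` is applied to all vectors that the adversary did not receive. -/
def act (M : Matrix (Fin n) (Fin n) (ZMod 2)) (k : MSK N n t) : MSK N n t where
  A := k.A
  v := fun i => if i ∈ k.Iadv then k.v i else Matrix.mulVec M (k.v i)
  w := fun j => if j ∈ k.Jadv then k.w j else Matrix.mulVec M (k.w j)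
  idxV := k.idxV
  idxW := k.idxW

/-- The key is good: each honest verifier has at least `t / 4` dimensions of `V_id` and of `W_id`
beyond those of the adversary. -/
def Good (k : MSK N n t) : Prop :=
  ∀ id : Fin (honestCount N n t),
    (Module.finrank (ZMod 2) k.Vadv : ℝ) + (t : ℝ) / 4 ≤
        Module.finrank (ZMod 2) ↥(k.Vadv ⊔ k.V (honest id)) ∧
      (Module.finrank (ZMod 2) k.Wadv : ℝ) + (t : ℝ) / 4 ≤
        Module.finrank (ZMod 2) ↥(k.Wadv ⊔ k.W (honest id))

end MSK

open Classical in
/-- The set of possible outputs of `Setup`. -/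
def setupSupport (N n t : ℕ) : Finset (MSK N n t) :=
  Finset.univ.filter fun k => k.Valid

/-- The expectation of `f msk` for `msk ← Setup`. The subspace `A`, then the `v_i ∈ A`, the
`w_j ∈ A^⊥` and all the indices are uniform and independent. Since the number of choices of the
latter does not depend on `A`, this is the uniform distribution on the possible outputs. -/
def setupExp {N n t : ℕ} (f : MSK N n t → ℝ) : ℝ :=
  (∑ k ∈ setupSupport N n t, f k) / ((setupSupport N n t).card : ℝ)

open Classical in
/-- The probability of an event for `msk ← Setup`. -/
def setupProb {N n t : ℕ} (E : MSK N n t → Prop) : ℝ :=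
  setupExp fun k => if E k then 1 else 0

/-! ### Verification oracles -/

/-- An oracle takes an honest identity, a selection bit and a vector, and returns a bit. -/
abbrev VerOracle (N n t : ℕ) : Type := Fin (honestCount N n t) → Bool → Vec n → Bool

/-- The franchised verification oracle: `O_{W_id^⊥}` for `s = 0`, `O_{V_id^⊥}` for `s = 1`. -/
def franOracle {N n t : ℕ} (k : MSK N n t) : VerOracle N n t :=
  fun id s x =>
    if s then memberOracle (perp (k.V (MSK.honest id))) x
    else memberOracle (perp (k.W (MSK.honest id))) x

/-- The full verification oracle: `O_A` for `s = 0`, `O_{A^⊥}` for `s = 1`. -/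
def fullOracle {N n t : ℕ} (A : Submodule (ZMod 2) (Vec n)) : VerOracle N n t :=
  fun _ s x => if s then memberOracle (perp A) x else memberOracle A x

/-- The query register: the bits of the identity, the selection bit, and the `n` bits of `x`. -/
abbrev QueryReg (N n t : ℕ) : Type := Fin (Nat.size (honestCount N n t)) ⊕ Unit ⊕ Fin n

/-- The oracle as a function of the bits in the query register. The identities are written in
binary and numbered from `0`; a bit string that encodes no identity is answered by `0`. -/
def VerOracle.onBits {N n t : ℕ} (O : VerOracle N n t) (q : QueryReg N n t → Bool) : Bool :=
  if h : Nat.ofBits (fun i => q (Sum.inl i)) < honestCount N n t then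
    O ⟨_, h⟩ (q (Sum.inr (Sum.inl ()))) (fun i => if q (Sum.inr (Sum.inr i)) then 1 else 0)
  else false

/-! ### Quantum circuits with oracle gates -/

/-- A unitary acting on finitely many qubits. -/
abbrev Gate : Type := Σ k : ℕ, Matrix.unitaryGroup (Fin k → Bool) ℂ

/-- The amplitudes of a state of `m` qubits in the computational basis. -/
abbrev QState (m : ℕ) : Type := (Fin m → Bool) → ℂ

/-- One step of a circuit on `m` qubits: a gate from the gate set `G` on distinct qubits, or an
oracle query with a query register of shape `Q` and a target qubit. -/
inductive Step (G : Finset Gate) (Q : Type) (m : ℕ) : Type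
  | gate (g : Gate) (hg : g ∈ G) (wires : Fin g.1 ↪ Fin m) : Step G Q m
  | query (wires : Q ↪ Fin m) (target : Fin m) (h : target ∉ Set.range wires) : Step G Q m

/-- A gate acts on its qubits as its unitary and on the others as the identity. A query maps
`|q, b⟩` to `|q, b ⊕ O(q)⟩`. -/
def Step.apply {G : Finset Gate} {Q : Type} {m : ℕ} (O : (Q → Bool) → Bool) :
    Step G Q m → QState m → QState m
  | .gate g _ e, ψ => fun x =>
      ∑ y : Fin g.1 → Bool,
        (g.2 : Matrix (Fin g.1 → Bool) (Fin g.1 → Bool) ℂ) (x ∘ e) y * ψ (Function.extend e y x)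
  | .query e b _, ψ => fun x => ψ (Function.update x b (xor (x b) (O (x ∘ e))))

/-- A quantum oracle circuit: a number of qubits, the classical string in which they are
initialized, the sequence of steps, and the qubit that is measured at the end. -/
structure Circuit (G : Finset Gate) (Q : Type) where
  width : ℕ
  input : Fin width → Bool
  steps : List (Step G Q width)
  output : Fin width

namespace Circuit

variable {G : Finset Gate} {Q : Type}

/-- The size of a circuit: qubits plus gates, every oracle query counting as one gate. -/
def size (c : Circuit G Q) : ℕ := c.width + c.steps.length

/-- The state at the end of the computation with oracle `O`. -/
def finalState (c : Circuit G Q) (O : (Q → Bool) → Bool) : QState c.width :=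
  c.steps.foldl (fun ψ s => s.apply O ψ) (Pi.single c.input 1)

/-- The probability that measuring the output qubit gives `1`. -/
def acceptProb (c : Circuit G Q) (O : (Q → Bool) → Bool) : ℝ :=
  ∑ x : Fin c.width → Bool, if x c.output then ‖c.finalState O x‖ ^ 2 else 0

end Circuit

/-! ### The distinguishing game -/

/-- An adversary with gates in `G`: for every security parameter and every master secret key (which
the adversary is given) the circuit that it runs, including its classical input. An adversary that
reads the key from its input qubits is the case where only the input string depends on the key. -/
abbrev Adversary (G : Finset Gate) (N n t : ℕ → ℕ) : Type :=
  ∀ κ : ℕ, MSK (N κ) (n κ) (t κ) → Circuit G (QueryReg (N κ) (n κ) (t κ))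

/-- Polynomial time: the size of the circuits is at most a polynomial in the security parameter. -/
def Adversary.PolyTime {G : Finset Gate} {N n t : ℕ → ℕ} (𝒜 : Adversary G N n t) : Prop :=
  ∃ p : Polynomial ℕ, ∀ κ, ∀ k ∈ setupSupport (N κ) (n κ) (t κ), (𝒜 κ k).size ≤ p.eval κ

/-- The probability that the circuit outputs `1` in the distinguishing game on input `msk`, given
the challenge bit: for `b = 0` it queries the full oracle of `A`, for `b = 1` the franchised oracle
of `M(msk)` with `M` uniform in `𝓜(A)`. -/
def gameProb {G : Finset Gate} {N n t : ℕ} (k : MSK N n t) (c : Circuit G (QueryReg N n t)) :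
    Bool → ℝ
  | false => c.acceptProb (VerOracle.onBits (fullOracle (N := N) (t := t) k.A))
  | true =>
      (∑ M ∈ preservingMatrices k.A, c.acceptProb (VerOracle.onBits (franOracle (k.act M)))) /
        ((preservingMatrices k.A).card : ℝ)

/-- The advantage `|P[𝒜 = 1 | b = 0] - P[𝒜 = 1 | b = 1]|` in the distinguishing game on input
`msk`. -/
def advantage {G : Finset Gate} {N n t : ℕ} (k : MSK N n t) (c : Circuit G (QueryReg N n t)) : ℝ :=
  |gameProb k c false - gameProb k c true|

/-- `f` is negligible: `κ ^ c * f κ → 0` for every `c`. -/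
def Negligible (f : ℕ → ℝ) : Prop :=
  SuperpolynomialDecay atTop (fun κ : ℕ => (κ : ℝ)) f

end FranchisedMoney

end

/-!
The proof is information-theoretic: it uses of the adversary only that it makes few oracle queries.

*Indistinguishability on a good key.* Let `M` be uniform in `𝓜(A)`. Since `M` maps `A^⊥` into
itself, the franchised oracle of `M(msk)` for `s = 0` accepts all of `A`, so it can disagree with
the full oracle only at some `x ∉ A`, and then `Mᵀ x` is orthogonal to the space `W` spanned by
the `w_j` of the verifier that the adversary did not receive. Goodness gives `dim W ≥ t / 4`.
Choose `b ∈ A^⊥` with `⟨x, b⟩ = 1`. For every `u ∈ A^⊥` orthogonal to `b`, left multiplication by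
the transvection `1 + b uᵀ` permutes `𝓜(A)` and replaces `Mᵀ x` by `Mᵀ (x + u)`. Averaging over
`u` shows that `Mᵀ x ∈ W^⊥` has probability at most `2 ^ (1 + dim (A ∩ A^⊥) - dim W)`
(`card_preserving_mul_le`). The case `s = 1` is the same with `A` and `A^⊥` exchanged. When
`dim (A ∩ A^⊥) ≤ ρ t` with `ρ < 1 / 4`, each query is thus answered wrongly with probability
exponentially small in `t`, and the hybrid argument for quantum queries
(`Circuit.abs_acceptProb_sub_avg_le`) bounds the advantage of a circuit with `q` steps by `q` times
an exponential in `-t` (`advantage_le`). As `t` is of order `√n`, this beats `2 ^ (-c n ^ (1 / 3))`.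

*Good keys.* The adversary knows at most `n / 4` of the `n / 2` indices. The exponential moment of
the number of new indices of a verifier gives a Chernoff bound
(`card_few_new_indices_le`): at least `t / 4` of them are new. The vectors indexed by the adversary
and one verifier number at most `n / 4 + t`, and such vectors in a space of dimension `n / 2` are
linearly independent except with probability `2 ^ (n / 4 + t - n / 2)`
(`card_not_linearIndepOn_mul_le`), in which case every new index contributes a new dimension.

*Small intersections.* Describing `A` by a random tuple `b` of `n / 2` vectors, the expected number
of combinations of `b` that are orthogonal to all of `b` is bounded by a constant, so the expected
size of `A ∩ A^⊥` is at most `8` (`sum_card_inf_perp_le`), and Markov's inequality bounds the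
probability that its dimension exceeds `ρ t`.

The expected advantage is at most the probability of a bad key plus the bound on good keys.
-/

namespace FranchisedMoney

/-! ### Orthogonal complements -/

section Perp

variable {n : ℕ}

lemma mem_perp {A : Submodule (ZMod 2) (Vec n)} {x : Vec n} :
    x ∈ perp A ↔ ∀ a ∈ A, x ⬝ᵥ a = 0 := Iff.rfl

lemma dotProductBilin_nondegenerate :
    (dotProductBilin (ZMod 2) (ZMod 2) : LinearMap.BilinForm (ZMod 2) (Vec n)).Nondegenerate := by
  constructor
  · intro x hx
    exact dotProduct_eq_zero x hx
  · intro x hx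
    exact dotProduct_eq_zero x fun y => by rw [dotProduct_comm]; exact hx y

lemma perp_eq_orthogonal (A : Submodule (ZMod 2) (Vec n)) :
    perp A = LinearMap.BilinForm.orthogonal
      (dotProductBilin (ZMod 2) (ZMod 2) : LinearMap.BilinForm (ZMod 2) (Vec n)) A := by
  ext x
  simp only [mem_perp, LinearMap.BilinForm.mem_orthogonal_iff,
    dotProductBilin_apply_apply]
  exact forall₂_congr fun a _ => by rw [dotProduct_comm]

lemma finrank_perp (A : Submodule (ZMod 2) (Vec n)) :
    Module.finrank (ZMod 2) (perp A) = n - Module.finrank (ZMod 2) A := by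
  rw [perp_eq_orthogonal, LinearMap.BilinForm.finrank_orthogonal dotProductBilin_nondegenerate]
  simp

lemma perp_perp (A : Submodule (ZMod 2) (Vec n)) : perp (perp A) = A := by
  rw [perp_eq_orthogonal (perp A), perp_eq_orthogonal A,
    LinearMap.BilinForm.orthogonal_orthogonal dotProductBilin_nondegenerate]
  intro x y h
  simpa [dotProduct_comm] using h

lemma perp_anti {A B : Submodule (ZMod 2) (Vec n)} (h : A ≤ B) : perp B ≤ perp A :=
  fun _ hx a ha => hx a (h ha)

lemma perp_sup (A B : Submodule (ZMod 2) (Vec n)) : perp (A ⊔ B) = perp A ⊓ perp B := by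
  apply le_antisymm (le_inf (perp_anti le_sup_left) (perp_anti le_sup_right))
  rintro x ⟨hA, hB⟩ y hy
  obtain ⟨a, ha, b, hb, rfl⟩ := Submodule.mem_sup.1 hy
  rw [dotProduct_add, hA a ha, hB b hb, add_zero]

lemma mem_perp_span {s : Set (Vec n)} {x : Vec n} :
    x ∈ perp (Submodule.span (ZMod 2) s) ↔ ∀ y ∈ s, x ⬝ᵥ y = 0 := by
  refine ⟨fun h y hy => h y (Submodule.subset_span hy), fun h a ha => ?_⟩
  induction ha using Submodule.span_induction with
  | mem y hy => exact h y hy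
  | zero => simp
  | add y z _ _ hy hz => rw [dotProduct_add, hy, hz, add_zero]
  | smul c y _ hy => rw [dotProduct_smul, hy, smul_zero]

lemma natCard_submodule {V : Type*} [AddCommGroup V] [Module (ZMod 2) V]
    [Module.Finite (ZMod 2) V] (A : Submodule (ZMod 2) V) :
    Nat.card A = 2 ^ Module.finrank (ZMod 2) A := by
  rw [Module.natCard_eq_pow_finrank (K := ZMod 2), Nat.card_zmod]

end Perp

/-! ### Random matrices preserving a subspace and its complement -/

section Preserving

open Matrix

variable {n : ℕ}

lemma mem_preservingMatrices {A : Submodule (ZMod 2) (Vec n)}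
    {M : Matrix (Fin n) (Fin n) (ZMod 2)} :
    M ∈ preservingMatrices A ↔ IsUnit M ∧ (∀ x ∈ A, Mᵀ *ᵥ x ∈ A) ∧
      ∀ x ∈ perp A, Mᵀ *ᵥ x ∈ perp A := by
  simp [preservingMatrices]

lemma preservingMatrices_perp (A : Submodule (ZMod 2) (Vec n)) :
    preservingMatrices (perp A) = preservingMatrices A := by
  ext M
  rw [mem_preservingMatrices, mem_preservingMatrices, perp_perp]
  tauto

lemma one_mem_preservingMatrices (A : Submodule (ZMod 2) (Vec n)) :
    (1 : Matrix (Fin n) (Fin n) (ZMod 2)) ∈ preservingMatrices A := by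
  simp [mem_preservingMatrices]

lemma preservingMatrices_card_pos (A : Submodule (ZMod 2) (Vec n)) :
    0 < (preservingMatrices A).card :=
  Finset.card_pos.2 ⟨1, one_mem_preservingMatrices A⟩

lemma mulVec_mem_perp {A : Submodule (ZMod 2) (Vec n)} {M : Matrix (Fin n) (Fin n) (ZMod 2)}
    (hM : M ∈ preservingMatrices A) {y : Vec n} (hy : y ∈ perp A) : M *ᵥ y ∈ perp A := by
  intro a ha
  rw [dotProduct_comm, dotProduct_mulVec, ← mulVec_transpose, dotProduct_comm]
  exact hy _ ((mem_preservingMatrices.1 hM).2.1 a ha)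

lemma transvection_transpose_mulVec (b u x : Vec n) (M : Matrix (Fin n) (Fin n) (ZMod 2)) :
    ((1 + vecMulVec b u) * M)ᵀ *ᵥ x = Mᵀ *ᵥ (x + (x ⬝ᵥ b) • u) := by
  rw [transpose_mul, ← mulVec_mulVec, transpose_add, transpose_one, add_mulVec, one_mulVec,
    transpose_vecMulVec, vecMulVec_mulVec, dotProduct_comm]
  simp

lemma transvection_mul_self {b u : Vec n} (h : u ⬝ᵥ b = 0) :
    (1 + vecMulVec b u) * (1 + vecMulVec b u) = (1 : Matrix (Fin n) (Fin n) (ZMod 2)) := by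
  have h0 : vecMulVec b u * vecMulVec b u = 0 := by
    rw [vecMulVec_mul_vecMulVec, h]
    simp
  rw [mul_add, add_mul, add_mul, h0, mul_one, one_mul, mul_one, add_zero, add_assoc,
    ZModModule.add_self, add_zero]

lemma transvection_mul_mem {A : Submodule (ZMod 2) (Vec n)} {b u : Vec n} (hb : b ∈ perp A)
    (hu : u ∈ perp A) (hbu : u ⬝ᵥ b = 0) {M : Matrix (Fin n) (Fin n) (ZMod 2)}
    (hM : M ∈ preservingMatrices A) : (1 + vecMulVec b u) * M ∈ preservingMatrices A := by
  obtain ⟨h1, h2, h3⟩ := mem_preservingMatrices.1 hM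
  refine mem_preservingMatrices.2 ⟨IsUnit.mul ?_ h1, fun x hx => ?_, fun x hx => ?_⟩
  · exact IsUnit.of_mul_eq_one _ (transvection_mul_self hbu)
  · rw [transvection_transpose_mulVec, dotProduct_comm, hb x hx, zero_smul, add_zero]
    exact h2 x hx
  · rw [transvection_transpose_mulVec]
    exact h3 _ (add_mem hx (Submodule.smul_mem _ _ hu))

lemma mulVec_transpose_injective {A : Submodule (ZMod 2) (Vec n)}
    {M : Matrix (Fin n) (Fin n) (ZMod 2)} (hM : M ∈ preservingMatrices A) :
    Function.Injective (Mᵀ *ᵥ ·) :=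
  Matrix.mulVec_injective_of_isUnit ((Matrix.isUnit_transpose M).2 (mem_preservingMatrices.1 hM).1)

/-- For a fixed `M` in `𝓜(A)`, the vectors `u` of a subspace of `A^⊥` that send `x + u` into
`W^⊥` under `Mᵀ` lie in a single coset of a space isomorphic to `A^⊥ ∩ W^⊥`. -/
lemma card_shift_le {A H W : Submodule (ZMod 2) (Vec n)} (hH : H ≤ perp A)
    {M : Matrix (Fin n) (Fin n) (ZMod 2)} (hM : M ∈ preservingMatrices A) (x : Vec n) :
    Nat.card {u : H // Mᵀ *ᵥ (x + (u : Vec n)) ∈ perp W} ≤ Nat.card ↥(perp A ⊓ perp W) := by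
  by_cases hne : Nonempty {u : H // Mᵀ *ᵥ (x + (u : Vec n)) ∈ perp W}
  · obtain ⟨u₀⟩ := hne
    refine Nat.card_le_card_of_injective
      (fun u => ⟨Mᵀ *ᵥ ((u.1 : Vec n) - u₀.1), ?_, ?_⟩) fun u u' h => ?_
    · exact (mem_preservingMatrices.1 hM).2.2 _ (sub_mem (hH u.1.2) (hH u₀.1.2))
    · have := sub_mem u.2 u₀.2
      rwa [← mulVec_sub, add_sub_add_left_eq_sub] at this
    · have := mulVec_transpose_injective hM (congrArg Subtype.val h)
      exact Subtype.ext (Subtype.ext (sub_left_injective this))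
  · rw [not_nonempty_iff] at hne
    simp

open Classical in
/-- For `x ∉ A` and a subspace `W` of `A^⊥`, a uniform `M` in `𝓜(A)` sends `x` into `W^⊥` under
`Mᵀ` with probability at most `2 ^ (1 + dim (A ∩ A^⊥) - dim W)`. Choose `b ∈ A^⊥` with
`⟨x, b⟩ = 1`. Multiplying `M` by the transvection `1 + b uᵀ` with `u ∈ A^⊥` orthogonal to `b`
permutes `𝓜(A)` and turns `Mᵀ x` into `Mᵀ (x + u)`, so it suffices to count the `u`. -/
theorem card_preserving_mul_le {A W : Submodule (ZMod 2) (Vec n)} {x : Vec n} (hx : x ∉ A)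
    (hW : W ≤ perp A) :
    ((preservingMatrices A).filter fun M => Mᵀ *ᵥ x ∈ perp W).card *
        2 ^ Module.finrank (ZMod 2) W ≤
      2 * 2 ^ Module.finrank (ZMod 2) ↥(A ⊓ perp A) * (preservingMatrices A).card := by
  obtain ⟨b, hb, hxb⟩ : ∃ b ∈ perp A, x ⬝ᵥ b = 1 := by
    rw [← perp_perp A, mem_perp] at hx
    push Not at hx
    obtain ⟨b, hb, h⟩ := hx
    exact ⟨b, hb, Fin.eq_one_of_ne_zero _ h⟩
  set H := perp (A ⊔ Submodule.span (ZMod 2) {b}) with hHdef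
  have hHA : H ≤ perp A := perp_anti le_sup_left
  have hHb : ∀ u ∈ H, u ⬝ᵥ b = 0 := fun u hu =>
    hu b (Submodule.mem_sup_right (Submodule.mem_span_singleton_self b))
  set S := preservingMatrices A with hS
  -- Count the pairs `(u, M)` for which `(1 + b uᵀ) M` is bad, in two ways.
  have key : Nat.card H * (S.filter fun M => Mᵀ *ᵥ x ∈ perp W).card ≤
      S.card * Nat.card ↥(perp A ⊓ perp W) := by
    have h1 : ∀ u : H, (S.filter fun M => Mᵀ *ᵥ x ∈ perp W).card =
        (S.filter fun M => Mᵀ *ᵥ (x + (u : Vec n)) ∈ perp W).card := by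
      intro u
      have hu := hHb u u.2
      have hh : ∀ M : Matrix (Fin n) (Fin n) (ZMod 2),
          (1 + vecMulVec b (u : Vec n)) * ((1 + vecMulVec b (u : Vec n)) * M) = M := fun M => by
        rw [← mul_assoc, transvection_mul_self hu, one_mul]
      refine Finset.card_nbij' (fun M => (1 + vecMulVec b (u : Vec n)) * M)
        (fun M => (1 + vecMulVec b (u : Vec n)) * M) ?_ ?_ (fun M _ => hh M) (fun M _ => hh M)
      · intro M hM
        simp only [Finset.coe_filter, Set.mem_ofPred_eq] at hM ⊢
        refine ⟨transvection_mul_mem hb (hHA u.2) hu hM.1, ?_⟩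
        rw [transvection_transpose_mulVec, add_dotProduct, hxb, hu, add_zero, one_smul, add_assoc,
          ZModModule.add_self, add_zero]
        exact hM.2
      · intro M hM
        simp only [Finset.coe_filter, Set.mem_ofPred_eq] at hM ⊢
        refine ⟨transvection_mul_mem hb (hHA u.2) hu hM.1, ?_⟩
        rw [transvection_transpose_mulVec, hxb, one_smul]
        exact hM.2
    calc Nat.card H * (S.filter fun M => Mᵀ *ᵥ x ∈ perp W).card
        = ∑ u : H, (S.filter fun M => Mᵀ *ᵥ (x + (u : Vec n)) ∈ perp W).card := by
          rw [Finset.sum_congr rfl fun u _ => (h1 u).symm]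
          simp
      _ = ∑ M ∈ S, (Finset.univ.filter fun u : H => Mᵀ *ᵥ (x + (u : Vec n)) ∈ perp W).card := by
          simp_rw [Finset.card_filter]
          rw [Finset.sum_comm]
      _ ≤ ∑ _M ∈ S, Nat.card ↥(perp A ⊓ perp W) := by
          refine Finset.sum_le_sum fun M hM => ?_
          rw [← Fintype.card_subtype, ← Nat.card_eq_fintype_card]
          exact card_shift_le hHA hM x
      _ = _ := by simp
  have hdim : Module.finrank (ZMod 2) ↥(perp A ⊓ perp W) + Module.finrank (ZMod 2) W ≤
      Module.finrank (ZMod 2) H + 1 + Module.finrank (ZMod 2) ↥(A ⊓ perp A) := by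
    rw [← perp_sup, hHdef, finrank_perp, finrank_perp]
    have h1 := Submodule.finrank_sup_add_finrank_inf_eq A W
    have h2 := Submodule.finrank_mono (inf_le_inf_left A hW)
    have h3 := Submodule.finrank_add_le_finrank_add_finrank A (Submodule.span (ZMod 2) {b})
    have h4 : Module.finrank (ZMod 2) (Submodule.span (ZMod 2) {b}) ≤ 1 := by
      simpa using finrank_span_le_card (R := ZMod 2) ({b} : Set (Vec n))
    have h5 := Submodule.finrank_le (A ⊔ W)
    simp only [Module.finrank_fin_fun] at h5
    omega
  have hpow := Nat.pow_le_pow_right (n := 2) two_pos hdim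
  rw [pow_add, pow_add, pow_add, pow_one, ← natCard_submodule (perp A ⊓ perp W),
    ← natCard_submodule H] at hpow
  have hpos : 0 < Nat.card H := Nat.card_pos
  refine Nat.le_of_mul_le_mul_left ?_ hpos
  calc _ = Nat.card H * (S.filter fun M => Mᵀ *ᵥ x ∈ perp W).card *
        2 ^ Module.finrank (ZMod 2) W := by ring
    _ ≤ S.card * Nat.card ↥(perp A ⊓ perp W) * 2 ^ Module.finrank (ZMod 2) W := by gcongr
    _ = S.card * (Nat.card ↥(perp A ⊓ perp W) * 2 ^ Module.finrank (ZMod 2) W) := by ring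
    _ ≤ S.card * (Nat.card H * 2 * 2 ^ Module.finrank (ZMod 2) ↥(A ⊓ perp A)) := by gcongr
    _ = _ := by ring

end Preserving

/-! ### Circuits with similar oracles behave similarly -/

section Circuits

open Matrix

variable {G : Finset Gate} {Q : Type} {m : ℕ}

/-- The Euclidean norm of a vector of amplitudes. -/
noncomputable def l2norm (ψ : QState m) : ℝ :=
  ‖(WithLp.toLp 2 ψ : EuclideanSpace ℂ (Fin m → Bool))‖

lemma l2norm_nonneg (ψ : QState m) : 0 ≤ l2norm ψ := norm_nonneg _

lemma l2norm_sq (ψ : QState m) : l2norm ψ ^ 2 = ∑ x, ‖ψ x‖ ^ 2 := by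
  rw [l2norm, EuclideanSpace.norm_sq_eq]

lemma l2norm_sub_le_add (ψ φ χ : QState m) :
    l2norm (ψ - χ) ≤ l2norm (ψ - φ) + l2norm (φ - χ) := by
  simp only [l2norm, WithLp.toLp_sub]
  exact norm_sub_le_norm_sub_add_norm_sub _ _ _

lemma abs_l2norm_sub_le (ψ φ : QState m) : |l2norm ψ - l2norm φ| ≤ l2norm (ψ - φ) := by
  simp only [l2norm, WithLp.toLp_sub]
  exact abs_norm_sub_norm_le _ _

lemma l2norm_zero : l2norm (0 : QState m) = 0 := by simp [l2norm]

lemma l2norm_single (x : Fin m → Bool) : l2norm (Pi.single x 1 : QState m) = 1 := by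
  simp [l2norm]

/-- Splitting the qubits into those on the wires `e` and the others. The default value `false` in
the inverse is never reached. -/
noncomputable def splitWires {k : ℕ} (e : Fin k ↪ Fin m) :
    (Fin m → Bool) ≃ (Fin k → Bool) × ({i // i ∉ Set.range e} → Bool) where
  toFun x := (x ∘ e, fun i => x i)
  invFun p := Function.extend e p.1
    (Function.extend (Subtype.val : {i // i ∉ Set.range e} → Fin m) p.2 fun _ => false)
  left_inv x := by
    ext i
    by_cases h : i ∈ Set.range e
    · obtain ⟨a, rfl⟩ := h
      simp [e.injective.extend_apply]
    · dsimp only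
      rw [Function.extend_apply' _ _ _ (by simpa using h)]
      exact Subtype.val_injective.extend_apply _ _ ⟨i, h⟩
  right_inv p := by
    refine Prod.ext ?_ ?_
    · ext a
      simp [e.injective.extend_apply]
    · ext i
      change Function.extend e _ _ (i : Fin m) = _
      rw [Function.extend_apply' _ _ _ (by simpa using i.2)]
      exact Subtype.val_injective.extend_apply _ _ i

lemma splitWires_symm_comp {k : ℕ} (e : Fin k ↪ Fin m)
    (p : (Fin k → Bool) × ({i // i ∉ Set.range e} → Bool)) :
    (splitWires e).symm p ∘ e = p.1 :=
  congrArg Prod.fst ((splitWires e).apply_symm_apply p)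

lemma extend_splitWires_symm {k : ℕ} (e : Fin k ↪ Fin m) (y y' : Fin k → Bool)
    (z : {i // i ∉ Set.range e} → Bool) :
    Function.extend e y' ((splitWires e).symm (y, z)) = (splitWires e).symm (y', z) := by
  ext i
  by_cases h : i ∈ Set.range e
  · obtain ⟨a, rfl⟩ := h
    simp [splitWires, e.injective.extend_apply]
  · have h' : ¬ ∃ a, e a = i := by simpa using h
    simp [splitWires, Function.extend_apply' _ _ _ h']

lemma sum_norm_sq_unitary_mulVec {ι : Type*} [Fintype ι] [DecidableEq ι]
    (U : Matrix.unitaryGroup ι ℂ) (φ : ι → ℂ) :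
    ∑ y, ‖((U : Matrix ι ι ℂ) *ᵥ φ) y‖ ^ 2 = ∑ y, ‖φ y‖ ^ 2 := by
  have h : ∀ v : ι → ℂ, ((∑ y, ‖v y‖ ^ 2 : ℝ) : ℂ) = star v ⬝ᵥ v := by
    intro v
    simp only [dotProduct, Pi.star_apply, Complex.ofReal_sum]
    refine Finset.sum_congr rfl fun y _ => ?_
    rw [Complex.star_def, Complex.conj_mul']
    norm_cast
  have : ((∑ y, ‖((U : Matrix ι ι ℂ) *ᵥ φ) y‖ ^ 2 : ℝ) : ℂ) = ((∑ y, ‖φ y‖ ^ 2 : ℝ) : ℂ) := by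
    rw [h, h, star_mulVec, ← dotProduct_mulVec, mulVec_mulVec]
    have hU : (U : Matrix ι ι ℂ)ᴴ * (U : Matrix ι ι ℂ) = 1 := Unitary.coe_star_mul_self U
    rw [hU, one_mulVec]
  exact_mod_cast this

/-- The basis permutation performed by an oracle query. -/
def queryPerm (O : (Q → Bool) → Bool) (e : Q ↪ Fin m) (b : Fin m) (hb : b ∉ Set.range e) :
    Equiv.Perm (Fin m → Bool) :=
  Function.Involutive.toPerm (fun x => Function.update x b (xor (x b) (O (x ∘ e)))) fun x => by
    have : ∀ c, Function.update x b c ∘ e = x ∘ e := fun c => by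
      ext a
      exact Function.update_of_ne (fun h => hb ⟨a, h⟩) _ _
    simp [this]

lemma queryPerm_apply_comp (O : (Q → Bool) → Bool) (e : Q ↪ Fin m) (b : Fin m)
    (hb : b ∉ Set.range e) (x : Fin m → Bool) : queryPerm O e b hb x ∘ e = x ∘ e := by
  ext a
  exact Function.update_of_ne (fun h => hb ⟨a, h⟩) _ _

lemma apply_query (O : (Q → Bool) → Bool) (e : Q ↪ Fin m) (b : Fin m)
    (hb : b ∉ Set.range e) (ψ : QState m) :
    (Step.query e b hb : Step G Q m).apply O ψ = fun x => ψ (queryPerm O e b hb x) := rfl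

lemma Step.apply_sub (O : (Q → Bool) → Bool) (s : Step G Q m) (ψ φ : QState m) :
    s.apply O (ψ - φ) = s.apply O ψ - s.apply O φ := by
  cases s with
  | gate g hg e =>
    ext x
    simp [Step.apply, mul_sub]
  | query e b hb => rfl

lemma Step.l2norm_apply (O : (Q → Bool) → Bool) (s : Step G Q m) (ψ : QState m) :
    l2norm (s.apply O ψ) = l2norm ψ := by
  rw [← sq_eq_sq₀ (l2norm_nonneg _) (l2norm_nonneg _), l2norm_sq, l2norm_sq]
  cases s with
  | gate g hg e =>
    rw [← (splitWires e).symm.sum_comp, ← (splitWires e).symm.sum_comp (fun x => ‖ψ x‖ ^ 2),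
      Fintype.sum_prod_type_right, Fintype.sum_prod_type_right]
    refine Finset.sum_congr rfl fun z _ => ?_
    rw [← sum_norm_sq_unitary_mulVec g.2 fun y => ψ ((splitWires e).symm (y, z))]
    simp only [Step.apply, splitWires_symm_comp, extend_splitWires_symm, mulVec, dotProduct]
  | query e b hb =>
    simp only [apply_query]
    exact Equiv.sum_comp (queryPerm O e b hb) fun x => ‖ψ x‖ ^ 2

/-- Changing the oracle in a query moves only the amplitudes at which the oracles differ. -/
lemma l2norm_query_sub_sq_le (O O' : (Q → Bool) → Bool)
    (e : Q ↪ Fin m) (b : Fin m) (hb : b ∉ Set.range e) (ψ : QState m) :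
    l2norm ((Step.query e b hb : Step G Q m).apply O' ψ -
      (Step.query e b hb : Step G Q m).apply O ψ) ^ 2 ≤ 4 * ∑ x : Fin m → Bool, if O' (x ∘ e) ≠ O (x ∘ e) then ‖ψ x‖ ^ 2 else 0 := by
  set f : (Fin m → Bool) → ℝ := fun x => if O' (x ∘ e) ≠ O (x ∘ e) then ‖ψ x‖ ^ 2 else 0 with hf
  have hinv : ∀ O'' : (Q → Bool) → Bool, ∑ x, f (queryPerm O'' e b hb x) = ∑ x, f x :=
    fun O'' => Equiv.sum_comp (queryPerm O'' e b hb) f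
  calc _ = ∑ x, ‖ψ (queryPerm O' e b hb x) - ψ (queryPerm O e b hb x)‖ ^ 2 := l2norm_sq _
    _ ≤ ∑ x, (2 * f (queryPerm O' e b hb x) + 2 * f (queryPerm O e b hb x)) := by
        refine Finset.sum_le_sum fun x _ => ?_
        simp only [hf, queryPerm_apply_comp]
        by_cases h : O' (x ∘ e) = O (x ∘ e)
        · have : queryPerm O' e b hb x = queryPerm O e b hb x := by
            change Function.update _ _ _ = Function.update _ _ _
            rw [h]
          simp [this, h]
        · simp only [ne_eq, h, not_false_eq_true, if_true]
          have h1 := norm_sub_le (ψ (queryPerm O' e b hb x)) (ψ (queryPerm O e b hb x))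
          have h2 := pow_le_pow_left₀ (norm_nonneg _) h1 2
          nlinarith [sq_nonneg (‖ψ (queryPerm O' e b hb x)‖ - ‖ψ (queryPerm O e b hb x)‖)]
    _ = _ := by
        rw [Finset.sum_add_distrib, ← Finset.mul_sum, ← Finset.mul_sum, hinv, hinv]
        ring

/-- One step of the hybrid argument: if every query is answered differently only by a fraction `ε`
of the oracles, then the average error made by replacing the oracle is at most `2 √ε`. -/
lemma sum_l2norm_apply_sub_le {ι : Type*} (S : Finset ι) (O : (Q → Bool) → Bool)
    (O' : ι → (Q → Bool) → Bool) {ε : ℝ} (hε : 0 ≤ ε)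
    (h : ∀ q, ((S.filter fun i => O' i q ≠ O q).card : ℝ) ≤ ε * S.card)
    (s : Step G Q m) (ψ : QState m) (hψ : l2norm ψ = 1) :
    ∑ i ∈ S, l2norm (s.apply (O' i) ψ - s.apply O ψ) ≤ S.card * (2 * √ε) := by
  cases s with
  | gate g hg e =>
    have : ∀ i, (Step.gate g hg e : Step G Q m).apply (O' i) ψ -
        (Step.gate g hg e : Step G Q m).apply O ψ = 0 := fun i => sub_self _
    simp only [this, l2norm_zero, Finset.sum_const_zero]
    positivity
  | query e b hb =>
    refine (abs_le_of_sq_le_sq' ?_ (by positivity)).2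
    refine sq_sum_le_card_mul_sum_sq.trans ?_
    have h1 : ∑ i ∈ S, l2norm ((Step.query e b hb : Step G Q m).apply (O' i) ψ -
        (Step.query e b hb : Step G Q m).apply O ψ) ^ 2 ≤ 4 * (ε * S.card) := by
      calc _ ≤ ∑ i ∈ S, 4 * ∑ x : Fin m → Bool,
              if O' i (x ∘ e) ≠ O (x ∘ e) then ‖ψ x‖ ^ 2 else 0 :=
            Finset.sum_le_sum fun i _ => l2norm_query_sub_sq_le O (O' i) e b hb ψ
        _ = 4 * ∑ x : Fin m → Bool,
              ((S.filter fun i => O' i (x ∘ e) ≠ O (x ∘ e)).card : ℝ) * ‖ψ x‖ ^ 2 := by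
            rw [← Finset.mul_sum, Finset.sum_comm]
            refine congrArg _ (Finset.sum_congr rfl fun x _ => ?_)
            rw [← Finset.sum_filter, Finset.sum_const, nsmul_eq_mul]
        _ ≤ 4 * ∑ x : Fin m → Bool, (ε * S.card) * ‖ψ x‖ ^ 2 := by
            gcongr with x
            exact h _
        _ = 4 * (ε * S.card) := by
            rw [← Finset.mul_sum, ← l2norm_sq, hψ]
            ring
    calc _ ≤ (S.card : ℝ) * (4 * (ε * S.card)) := by gcongr
      _ = (S.card * (2 * √ε)) ^ 2 := by
          rw [mul_pow, mul_pow, Real.sq_sqrt hε]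
          ring

lemma l2norm_foldl (O : (Q → Bool) → Bool) (L : List (Step G Q m)) (ψ : QState m) :
    l2norm (L.foldl (fun ψ s => s.apply O ψ) ψ) = l2norm ψ := by
  induction L generalizing ψ with
  | nil => rfl
  | cons s L ih => rw [List.foldl_cons, ih, Step.l2norm_apply]

/-- The hybrid argument: the errors of the individual steps add up. -/
lemma sum_l2norm_foldl_sub_le {ι : Type*} (S : Finset ι) (O : (Q → Bool) → Bool)
    (O' : ι → (Q → Bool) → Bool) {ε : ℝ} (hε : 0 ≤ ε)
    (h : ∀ q, ((S.filter fun i => O' i q ≠ O q).card : ℝ) ≤ ε * S.card)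
    (L : List (Step G Q m)) (ψ : QState m) (hψ : l2norm ψ = 1) (ψ' : ι → QState m) :
    ∑ i ∈ S, l2norm (L.foldl (fun φ s => s.apply (O' i) φ) (ψ' i) -
        L.foldl (fun φ s => s.apply O φ) ψ) ≤
      ∑ i ∈ S, l2norm (ψ' i - ψ) + L.length * (S.card * (2 * √ε)) := by
  induction L generalizing ψ ψ' with
  | nil => simp
  | cons s L ih =>
    simp only [List.foldl_cons, List.length_cons, Nat.cast_add, Nat.cast_one]
    refine (ih (s.apply O ψ) (by rw [s.l2norm_apply, hψ]) fun i => s.apply (O' i) (ψ' i)).trans ?_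
    have h1 : ∑ i ∈ S, l2norm (s.apply (O' i) (ψ' i) - s.apply O ψ) ≤
        ∑ i ∈ S, l2norm (ψ' i - ψ) + S.card * (2 * √ε) := by
      refine le_trans ?_ (add_le_add_right (sum_l2norm_apply_sub_le S O O' hε h s ψ hψ) _)
      rw [← Finset.sum_add_distrib]
      refine Finset.sum_le_sum fun i _ =>
        (l2norm_sub_le_add _ (s.apply (O' i) ψ) _).trans (le_of_eq ?_)
      rw [← Step.apply_sub, Step.l2norm_apply]
    linarith

/-- The projection of a state onto the subspace on which the output qubit is `1`. -/
def acceptPart (b : Fin m) (ψ : QState m) : QState m := fun x => if x b then ψ x else 0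

lemma l2norm_acceptPart_le (b : Fin m) (ψ : QState m) : l2norm (acceptPart b ψ) ≤ l2norm ψ := by
  refine (abs_le_of_sq_le_sq' ?_ (l2norm_nonneg _)).2
  rw [l2norm_sq, l2norm_sq]
  refine Finset.sum_le_sum fun x _ => ?_
  unfold acceptPart
  split_ifs <;> simp

lemma acceptPart_sub (b : Fin m) (ψ φ : QState m) :
    acceptPart b (ψ - φ) = acceptPart b ψ - acceptPart b φ := by
  ext x
  simp only [acceptPart, Pi.sub_apply]
  split_ifs <;> simp

namespace Circuit

lemma l2norm_finalState (c : Circuit G Q) (O : (Q → Bool) → Bool) :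
    l2norm (c.finalState O) = 1 := by
  rw [finalState, l2norm_foldl, l2norm_single]

lemma acceptProb_eq (c : Circuit G Q) (O : (Q → Bool) → Bool) :
    c.acceptProb O = l2norm (acceptPart c.output (c.finalState O)) ^ 2 := by
  rw [l2norm_sq, acceptProb]
  refine Finset.sum_congr rfl fun x _ => ?_
  unfold acceptPart
  split_ifs <;> simp

lemma l2norm_acceptPart_finalState_le (c : Circuit G Q) (O : (Q → Bool) → Bool) :
    l2norm (acceptPart c.output (c.finalState O)) ≤ 1 :=
  (l2norm_acceptPart_le _ _).trans (c.l2norm_finalState O).le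

lemma acceptProb_nonneg (c : Circuit G Q) (O : (Q → Bool) → Bool) : 0 ≤ c.acceptProb O := by
  rw [acceptProb_eq]
  positivity

lemma acceptProb_le_one (c : Circuit G Q) (O : (Q → Bool) → Bool) : c.acceptProb O ≤ 1 := by
  rw [acceptProb_eq]
  exact pow_le_one₀ (l2norm_nonneg _) (c.l2norm_acceptPart_finalState_le O)

lemma abs_acceptProb_sub_le (c : Circuit G Q) (O O' : (Q → Bool) → Bool) :
    |c.acceptProb O - c.acceptProb O'| ≤ 2 * l2norm (c.finalState O' - c.finalState O) := by
  have h1 := c.l2norm_acceptPart_finalState_le O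
  have h2 := c.l2norm_acceptPart_finalState_le O'
  have h3 := l2norm_nonneg (acceptPart c.output (c.finalState O))
  have h4 := l2norm_nonneg (acceptPart c.output (c.finalState O'))
  have h5 := abs_l2norm_sub_le (acceptPart c.output (c.finalState O'))
    (acceptPart c.output (c.finalState O))
  rw [← acceptPart_sub] at h5
  have h6 := h5.trans (l2norm_acceptPart_le _ _)
  rw [acceptProb_eq, acceptProb_eq, sq_sub_sq, abs_mul, abs_of_nonneg (add_nonneg h3 h4),
    abs_sub_comm]
  exact mul_le_mul (by linarith) h6 (abs_nonneg _) zero_le_two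

/-- If every query is answered differently from `O` only by a fraction `ε` of a family of oracles,
then a circuit distinguishes `O` from a random member of the family with advantage at most
`4 √ε` per step. -/
theorem abs_acceptProb_sub_avg_le (c : Circuit G Q) {ι : Type*} (S : Finset ι)
    (hS : S.Nonempty) (O : (Q → Bool) → Bool) (O' : ι → (Q → Bool) → Bool) {ε : ℝ} (hε : 0 ≤ ε)
    (h : ∀ q, ((S.filter fun i => O' i q ≠ O q).card : ℝ) ≤ ε * S.card) :
    |c.acceptProb O - (∑ i ∈ S, c.acceptProb (O' i)) / S.card| ≤ 4 * c.steps.length * √ε := by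
  have hpos : (0 : ℝ) < S.card := by exact_mod_cast hS.card_pos
  have h1 : c.acceptProb O - (∑ i ∈ S, c.acceptProb (O' i)) / S.card =
      (∑ i ∈ S, (c.acceptProb O - c.acceptProb (O' i))) / S.card := by
    rw [Finset.sum_sub_distrib, Finset.sum_const, nsmul_eq_mul]
    field_simp
  rw [h1, abs_div, abs_of_pos hpos, div_le_iff₀ hpos]
  have h2 := sum_l2norm_foldl_sub_le S O O' hε h c.steps _ (l2norm_single c.input)
    fun _ => Pi.single c.input 1
  simp only [sub_self, l2norm_zero, Finset.sum_const_zero, zero_add] at h2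
  calc _ ≤ ∑ i ∈ S, |c.acceptProb O - c.acceptProb (O' i)| := Finset.abs_sum_le_sum_abs _ _
    _ ≤ ∑ i ∈ S, 2 * l2norm (c.finalState (O' i) - c.finalState O) :=
        Finset.sum_le_sum fun i _ => c.abs_acceptProb_sub_le O (O' i)
    _ ≤ 2 * (c.steps.length * (S.card * (2 * √ε))) := by
        rw [← Finset.mul_sum]
        exact mul_le_mul_of_nonneg_left h2 zero_le_two
    _ = _ := by ring

end Circuit

end Circuits

/-! ### The advantage on a good key -/

section GoodKeys

open Matrix

open Classical in
/-- A franchised membership oracle is wrong at a fixed point only with small probability over `M`: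
it accepts all of `A`, and it accepts `x ∉ A` only if `Mᵀ x` is orthogonal to the vectors that the
adversary did not receive, which span a space of dimension at least `δ`. -/
lemma card_memberOracle_ne_le {n : ℕ} {ι : Type*} {A : Submodule (ZMod 2) (Vec n)}
    (w : ι → Vec n) (hw : ∀ j, w j ∈ perp A) (J Jadv : Set ι) {δ : ℝ}
    (hδ : (Module.finrank (ZMod 2) (Submodule.span (ZMod 2) (w '' Jadv)) : ℝ) + δ ≤
      Module.finrank (ZMod 2)
        ↥(Submodule.span (ZMod 2) (w '' Jadv) ⊔ Submodule.span (ZMod 2) (w '' J)))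
    (x : Vec n) :
    (((preservingMatrices A).filter fun M =>
        memberOracle (perp (Submodule.span (ZMod 2)
          ((fun j => if j ∈ Jadv then w j else M *ᵥ w j) '' J))) x ≠ memberOracle A x).card : ℝ) ≤
      2 * 2 ^ ((Module.finrank (ZMod 2) ↥(A ⊓ perp A) : ℝ) - δ) * (preservingMatrices A).card := by
  by_cases hx : x ∈ A
  · rw [Finset.filter_false_of_mem, Finset.card_empty, Nat.cast_zero]
    · positivity
    · intro M hM
      have : x ∈ perp (Submodule.span (ZMod 2)
          ((fun j => if j ∈ Jadv then w j else M *ᵥ w j) '' J)) := by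
        rw [mem_perp_span]
        rintro _ ⟨j, -, rfl⟩
        dsimp only
        rw [dotProduct_comm]
        split_ifs
        · exact hw j x hx
        · exact mulVec_mem_perp hM (hw j) x hx
      simp [memberOracle, hx, this]
  · set W := Submodule.span (ZMod 2) (w '' (J \ Jadv)) with hW
    have hWA : W ≤ perp A := by
      rw [hW, Submodule.span_le]
      rintro _ ⟨j, -, rfl⟩
      exact hw j
    have hdim : δ ≤ Module.finrank (ZMod 2) W := by
      have h1 : Submodule.span (ZMod 2) (w '' Jadv) ⊔ Submodule.span (ZMod 2) (w '' J) ≤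
          Submodule.span (ZMod 2) (w '' Jadv) ⊔ W := by
        rw [hW, ← Submodule.span_union, ← Submodule.span_union, ← Set.image_union,
          ← Set.image_union, Set.union_sdiff_self]
      have h2 := (Submodule.finrank_mono h1).trans
        (Submodule.finrank_add_le_finrank_add_finrank _ _)
      have h3 : (_ : ℝ) ≤ _ := Nat.cast_le.2 h2
      push_cast at h3
      linarith
    have hsub : ((preservingMatrices A).filter fun M =>
        memberOracle (perp (Submodule.span (ZMod 2)
          ((fun j => if j ∈ Jadv then w j else M *ᵥ w j) '' J))) x ≠ memberOracle A x) ⊆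
        (preservingMatrices A).filter fun M => Mᵀ *ᵥ x ∈ perp W := by
      intro M
      simp only [Finset.mem_filter, memberOracle, hx, decide_false, ne_eq, decide_eq_false_iff_not,
        not_not, hW, mem_perp_span, Set.forall_mem_image]
      refine fun h => ⟨h.1, fun j hj => ?_⟩
      have := h.2 hj.1
      rw [if_neg hj.2] at this
      rw [mulVec_transpose, ← dotProduct_mulVec]
      exact this
    have hcard := (Nat.mul_le_mul_right _ (Finset.card_le_card hsub)).trans
      (card_preserving_mul_le hx hWA)
    have hcard' : (_ : ℝ) ≤ _ := Nat.cast_le.2 hcard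
    push_cast at hcard'
    rw [Real.rpow_sub two_pos, Real.rpow_natCast, mul_div_assoc', div_mul_eq_mul_div,
      le_div_iff₀ (by positivity)]
    refine le_trans ?_ hcard'
    gcongr
    rw [← Real.rpow_natCast]
    exact Real.rpow_le_rpow_of_exponent_le one_le_two hdim

variable {N n t : ℕ}

open Classical in
lemma card_franOracle_ne_le {k : MSK N n t} (hk : k.Valid) (hg : k.Good)
    (id : Fin (honestCount N n t)) (s : Bool) (x : Vec n) :
    (((preservingMatrices k.A).filter fun M =>
        franOracle (k.act M) id s x ≠ fullOracle (N := N) (t := t) k.A id s x).card : ℝ) ≤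
      2 * 2 ^ ((Module.finrank (ZMod 2) ↥(k.A ⊓ perp k.A) : ℝ) - t / 4) *
        (preservingMatrices k.A).card := by
  cases s with
  | false => exact card_memberOracle_ne_le k.w hk.2.2.2 _ _ (hg id).2 x
  | true =>
    have h := card_memberOracle_ne_le (A := perp k.A) k.v
      (by rw [perp_perp]; exact hk.2.2.1) _ _ (hg id).1 x
    rw [preservingMatrices_perp, perp_perp, inf_comm] at h
    exact h

/-- The advantage on a good key of a circuit with `q` steps is at most `4 q √ε`, where `ε`
bounds the probability that the franchised oracle is wrong at a fixed point. -/
theorem advantage_le {G : Finset Gate} {k : MSK N n t} (hk : k.Valid) (hg : k.Good)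
    (c : Circuit G (QueryReg N n t)) :
    advantage k c ≤ 4 * c.steps.length *
      √(2 * 2 ^ ((Module.finrank (ZMod 2) ↥(k.A ⊓ perp k.A) : ℝ) - t / 4)) := by
  classical
  refine c.abs_acceptProb_sub_avg_le _ ⟨1, one_mem_preservingMatrices _⟩ _ _ (by positivity)
    fun q => ?_
  unfold VerOracle.onBits
  split_ifs with h
  · exact card_franOracle_ne_le hk hg _ _ _
  · simp only [ne_eq, not_true_eq_false, Finset.filter_false, Finset.card_empty, Nat.cast_zero]
    positivity

lemma advantage_nonneg {G : Finset Gate} (k : MSK N n t) (c : Circuit G (QueryReg N n t)) :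
    0 ≤ advantage k c := abs_nonneg _

lemma advantage_le_one {G : Finset Gate} (k : MSK N n t) (c : Circuit G (QueryReg N n t)) :
    advantage k c ≤ 1 := by
  have hpos : (0 : ℝ) < (preservingMatrices k.A).card := by
    exact_mod_cast preservingMatrices_card_pos k.A
  have h0 : 0 ≤ gameProb k c true :=
    div_nonneg (Finset.sum_nonneg fun _ _ => c.acceptProb_nonneg _) hpos.le
  have h1 : gameProb k c true ≤ 1 := by
    refine (div_le_one hpos).2 ?_
    refine (Finset.sum_le_sum fun _ _ => c.acceptProb_le_one _).trans ?_
    simp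
  have h2 : 0 ≤ gameProb k c false := c.acceptProb_nonneg _
  have h3 : gameProb k c false ≤ 1 := c.acceptProb_le_one _
  exact abs_sub_le_iff.2 ⟨by linarith, by linarith⟩

end GoodKeys

/-! ### Counting lemmas for random indices and random vectors -/

section Counting

/-- The sequential exposure bound: while the `s` samples are drawn, at most `m / 2 + t` of the `m`
indices lie in `S` or have been seen before, and every other index halves the weight. -/
lemma sum_half_pow_card_le {m t : ℕ} (S : Finset (Fin m)) (hS : 2 * S.card ≤ m) (s : ℕ)
    (hs : s ≤ t) :
    ∑ f : Fin s → Fin m, (1 / 2 : ℝ) ^ (Finset.univ.image f \ S).card ≤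
      (3 / 4 * m + t / 2 : ℝ) ^ s := by
  induction s with
  | zero => simp
  | succ s ih =>
    rw [← (Fin.consEquiv fun _ : Fin (s + 1) => Fin m).sum_comp, Fintype.sum_prod_type_right]
    have hstep : ∀ f : Fin s → Fin m,
        ∑ a : Fin m, (1 / 2 : ℝ) ^
          (Finset.univ.image ((Fin.consEquiv fun _ : Fin (s + 1) => Fin m) (a, f)) \ S).card ≤
        (1 / 2 : ℝ) ^ (Finset.univ.image f \ S).card * (3 / 4 * m + t / 2) := by
      intro f
      set T := S ∪ Finset.univ.image f with hT
      have himg : ∀ a : Fin m,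
          Finset.univ.image ((Fin.consEquiv fun _ : Fin (s + 1) => Fin m) (a, f)) =
            insert a (Finset.univ.image f) := by
        intro a
        ext b
        simp [Fin.consEquiv, Fin.exists_fin_succ, eq_comm]
      have hterm : ∀ a : Fin m, (1 / 2 : ℝ) ^
          (Finset.univ.image ((Fin.consEquiv fun _ : Fin (s + 1) => Fin m) (a, f)) \ S).card =
          (1 / 2 : ℝ) ^ (Finset.univ.image f \ S).card * (1 / 2 + if a ∈ T then 1 / 2 else 0) := by
        intro a
        rw [himg]
        by_cases ha : a ∈ T
        · have : insert a (Finset.univ.image f) \ S = Finset.univ.image f \ S := by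
            rcases Finset.mem_union.1 ha with h | h
            · exact Finset.insert_sdiff_of_mem _ h
            · rw [Finset.insert_eq_of_mem h]
          rw [this, if_pos ha]
          norm_num
        · rw [if_neg ha]
          rw [hT, Finset.mem_union, not_or] at ha
          rw [Finset.insert_sdiff_of_notMem _ ha.1, Finset.card_insert_of_notMem, pow_succ]
          · ring
          · exact fun h => ha.2 (Finset.mem_sdiff.1 h).1
      rw [Finset.sum_congr rfl fun a _ => hterm a, ← Finset.mul_sum]
      refine mul_le_mul_of_nonneg_left ?_ (by positivity)
      rw [Finset.sum_add_distrib, ← Finset.sum_filter, Finset.sum_const, Finset.sum_const,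
        Finset.filter_univ_mem, Finset.card_univ, Fintype.card_fin, nsmul_eq_mul, nsmul_eq_mul]
      have h1 : T.card ≤ S.card + s := (Finset.card_union_le _ _).trans
        (Nat.add_le_add_left (Finset.card_image_le.trans (by simp)) _)
      have h2 : (T.card : ℝ) ≤ S.card + s := by exact_mod_cast h1
      have h3 : (2 : ℝ) * S.card ≤ m := by exact_mod_cast hS
      have h4 : (s : ℝ) ≤ t := by exact_mod_cast (Nat.le_succ s).trans hs
      linarith
    calc _ ≤ ∑ f : Fin s → Fin m,
          (1 / 2 : ℝ) ^ (Finset.univ.image f \ S).card * (3 / 4 * m + t / 2) :=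
          Finset.sum_le_sum fun f _ => hstep f
      _ ≤ _ := by
          rw [← Finset.sum_mul, pow_succ]
          exact mul_le_mul_of_nonneg_right (ih ((Nat.le_succ s).trans hs)) (by positivity)

/-- A Chernoff bound: few sample sequences of length `t` have less than `t / 4` distinct values
outside a set `S` of at most half of the indices. -/
lemma card_few_new_indices_le {m t : ℕ} (S : Finset (Fin m)) (hS : 2 * S.card ≤ m) :
    ((Finset.univ.filter fun f : Fin t → Fin m =>
      4 * (Finset.univ.image f \ S).card < t).card : ℝ) ≤
      (6 / 5 * (3 / 4 * m + t / 2) : ℝ) ^ t := by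
  rw [mul_pow]
  refine le_trans ?_ (mul_le_mul_of_nonneg_left (sum_half_pow_card_le S hS t le_rfl)
    (by positivity))
  rw [Finset.card_filter, Nat.cast_sum, Finset.mul_sum]
  refine Finset.sum_le_sum fun f _ => ?_
  split_ifs with h
  · set X := (Finset.univ.image f \ S).card
    -- `2 ≤ (6 / 5) ^ 4` turns the weight `2 ^ X` into at most `(6 / 5) ^ t`.
    have h1 : (2 : ℝ) ^ X ≤ (6 / 5) ^ t :=
      calc (2 : ℝ) ^ X ≤ ((6 / 5) ^ 4) ^ X := pow_le_pow_left₀ (by norm_num) (by norm_num) _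
        _ = (6 / 5) ^ (4 * X) := (pow_mul _ _ _).symm
        _ ≤ (6 / 5) ^ t := pow_le_pow_right₀ (by norm_num) h.le
    have h2 : (2 : ℝ) ^ X * (1 / 2) ^ X = 1 := by rw [← mul_pow]; norm_num
    rw [Nat.cast_one]
    exact h2.ge.trans (mul_le_mul_of_nonneg_right h1 (by positivity))
  · simp only [Nat.cast_zero]
    positivity

variable {ι V : Type*} [Fintype ι] [AddCommGroup V] [Module (ZMod 2) V] [Fintype V]

open Classical in
lemma card_linear_relation_mul {D : Finset ι} {z : D → ZMod 2} (hz : z ≠ 0) :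
    (Finset.univ.filter fun v : ι → V => ∑ i : D, z i • v i = 0).card * Fintype.card V =
      Fintype.card V ^ Fintype.card ι := by
  obtain ⟨i₀, hi₀⟩ := Function.ne_iff.1 hz
  have hi₁ : z i₀ = 1 := Fin.eq_one_of_ne_zero _ hi₀
  let L : (ι → V) →+ V :=
    { toFun := fun v => ∑ i : D, z i • v i
      map_zero' := by simp
      map_add' := fun v v' => by simp [Finset.sum_add_distrib] }
  have hL : Function.Surjective L := by
    intro a
    refine ⟨Pi.single (i₀ : ι) a, ?_⟩
    change ∑ i : D, z i • (Pi.single (i₀ : ι) a : ι → V) i = a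
    rw [Finset.sum_eq_single i₀]
    · simp [hi₁]
    · intro i _ hi
      rw [Pi.single_eq_of_ne (fun h => hi (Subtype.ext h)), smul_zero]
    · simp
  have h1 := L.ker.card_mul_index
  rw [AddSubgroup.index_ker, AddMonoidHom.range_eq_top.2 hL, AddSubgroup.card_top,
    Nat.card_eq_fintype_card, Nat.card_eq_fintype_card, Nat.card_eq_fintype_card,
    Fintype.card_fun] at h1
  rw [← h1, ← Fintype.card_subtype]
  congr 1
  exact Fintype.card_congr (Equiv.refl _)

open Classical in
/-- Uniform vectors with indices in `D` are linearly dependent with probability at most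
`2 ^ |D| / |V|`, by the union bound over the possible linear relations. -/
lemma card_not_linearIndepOn_mul_le (D : Finset ι) :
    (Finset.univ.filter fun v : ι → V => ¬ LinearIndepOn (ZMod 2) v (D : Set ι)).card *
      Fintype.card V ≤ 2 ^ D.card * Fintype.card V ^ Fintype.card ι := by
  have hsub : (Finset.univ.filter fun v : ι → V => ¬ LinearIndepOn (ZMod 2) v (D : Set ι)) ⊆
      (Finset.univ.filter fun z : D → ZMod 2 => z ≠ 0).biUnion
        fun z => Finset.univ.filter fun v : ι → V => ∑ i : D, z i • v i = 0 := by
    intro v hv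
    simp only [Finset.mem_filter, Finset.mem_univ, true_and, Finset.mem_biUnion] at hv ⊢
    by_contra hcon
    push Not at hcon
    refine hv (Fintype.linearIndependent_iff.2 fun g hg i => ?_)
    by_contra hi
    exact hcon g (fun h => hi (congrFun h i)) hg
  calc _ ≤ (∑ z ∈ Finset.univ.filter fun z : D → ZMod 2 => z ≠ 0,
        (Finset.univ.filter fun v : ι → V => ∑ i : D, z i • v i = 0).card) *
          Fintype.card V :=
        Nat.mul_le_mul_right _ ((Finset.card_le_card hsub).trans Finset.card_biUnion_le)
    _ = ∑ z ∈ Finset.univ.filter fun z : D → ZMod 2 => z ≠ 0,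
          Fintype.card V ^ Fintype.card ι := by
        rw [Finset.sum_mul]
        exact Finset.sum_congr rfl fun z hz =>
          card_linear_relation_mul (Finset.mem_filter.1 hz).2
    _ ≤ ∑ _z : D → ZMod 2, Fintype.card V ^ Fintype.card ι :=
        Finset.sum_le_sum_of_subset (Finset.filter_subset _ _)
    _ = _ := by
        rw [Finset.sum_const, Finset.card_univ, Fintype.card_fun, ZMod.card, Fintype.card_coe,
          smul_eq_mul]

end Counting

/-! ### The intersection of a random half-dimensional space with its complement -/

section HalfSpaces

variable {n : ℕ}

open Classical in
/-- The subspaces `A` with `dim A = dim A^⊥ = n / 2`. -/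
noncomputable def halfSpaces (n : ℕ) : Finset (Submodule (ZMod 2) (Vec n)) :=
  letI := Fintype.ofFinite (Submodule (ZMod 2) (Vec n))
  Finset.univ.filter fun A =>
    Module.finrank (ZMod 2) A = n / 2 ∧ Module.finrank (ZMod 2) (perp A) = n / 2

lemma mem_halfSpaces {A : Submodule (ZMod 2) (Vec n)} : A ∈ halfSpaces n ↔
    Module.finrank (ZMod 2) A = n / 2 ∧ Module.finrank (ZMod 2) (perp A) = n / 2 := by
  simp [halfSpaces]

open Classical in
lemma card_dotProduct_eq_zero {y : Vec n} (hy : y ≠ 0) :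
    Fintype.card {x : Vec n // y ⬝ᵥ x = 0} = 2 ^ (n - 1) := by
  have h1 := natCard_submodule (perp (Submodule.span (ZMod 2) {y}))
  rw [finrank_perp, finrank_span_singleton hy] at h1
  rw [← h1, ← Nat.card_eq_fintype_card]
  refine Nat.card_congr (Equiv.subtypeEquivRight fun x => ?_)
  simp [mem_perp_span, dotProduct_comm]

open Classical in
/-- Tuples of vectors, one of which is orthogonal to all others. -/
lemma card_orthogonal_to_others_le {m : ℕ} (i₀ : Fin m) :
    (Finset.univ.filter fun b : Fin m → Vec n => ∀ j ≠ i₀, b i₀ ⬝ᵥ b j = 0).card ≤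
      2 ^ (n * (m - 1)) + 2 ^ n * 2 ^ ((n - 1) * (m - 1)) := by
  rw [Finset.card_filter, ← (Equiv.funSplitAt i₀ (Vec n)).symm.sum_comp, Fintype.sum_prod_type]
  have hinner : ∀ y : Vec n, (∑ r : {j // j ≠ i₀} → Vec n,
      if ∀ j ≠ i₀, (Equiv.funSplitAt i₀ (Vec n)).symm (y, r) i₀ ⬝ᵥ
        (Equiv.funSplitAt i₀ (Vec n)).symm (y, r) j = 0 then 1 else 0) =
      Fintype.card {x : Vec n // y ⬝ᵥ x = 0} ^ (m - 1) := by
    intro y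
    have hcard : Fintype.card {j // j ≠ i₀} = m - 1 := by
      simp [Fintype.card_subtype_compl]
    rw [← Finset.card_filter, ← Fintype.card_subtype, ← hcard, ← Fintype.card_fun]
    refine Fintype.card_congr (Equiv.trans (Equiv.subtypeEquivRight fun r => ?_)
      (Equiv.subtypePiEquivPi (p := fun _ x => y ⬝ᵥ x = 0)))
    rw [Subtype.forall]
    refine forall₂_congr fun j hj => ?_
    simp [hj]
  rw [Finset.sum_congr rfl fun y _ => hinner y, ← Finset.add_sum_erase _ _ (Finset.mem_univ 0)]
  refine Nat.add_le_add ?_ ?_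
  · rw [pow_mul]
    refine Nat.pow_le_pow_left ((Fintype.card_subtype_le _).trans ?_) _
    simp [Vec]
  · rw [Finset.sum_congr rfl fun y hy => by
      rw [card_dotProduct_eq_zero (Finset.ne_of_mem_erase hy), ← pow_mul],
      Finset.sum_const, smul_eq_mul]
    refine Nat.mul_le_mul_right _ ((Finset.card_le_card (Finset.erase_subset _ _)).trans ?_)
    simp [Vec]

open Classical in
/-- For fixed coefficients `c` with `c i₀ ≠ 0`, replacing `b i₀` by the combination
`x = ∑ i, c i • b i` permutes the tuples, so that `x` is orthogonal to all of them rarely. -/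
lemma card_combination_orthogonal_le {m : ℕ} {c : Fin m → ZMod 2} (hc : c ≠ 0) :
    (Finset.univ.filter fun b : Fin m → Vec n =>
      ∀ j, (∑ i, c i • b i) ⬝ᵥ b j = 0).card ≤
      2 ^ (n * (m - 1)) + 2 ^ n * 2 ^ ((n - 1) * (m - 1)) := by
  obtain ⟨i₀, hi₀⟩ := Function.ne_iff.1 hc
  have hi₁ : c i₀ = 1 := Fin.eq_one_of_ne_zero _ hi₀
  refine le_trans ?_ (card_orthogonal_to_others_le i₀)
  refine Finset.card_le_card_of_injOn (fun b => Function.update b i₀ (∑ i, c i • b i)) ?_ ?_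
  · intro b hb
    simp only [Finset.coe_filter, Finset.mem_univ, true_and, Set.mem_ofPred_eq] at hb ⊢
    intro j hj
    rw [Function.update_self, Function.update_of_ne hj]
    exact hb j
  · intro b _ b' _ h
    have hne : ∀ j ≠ i₀, b j = b' j := fun j hj => by
      have := congrFun h j
      simpa [Function.update_of_ne hj] using this
    have hsum : ∑ i, c i • b i = ∑ i, c i • b' i := by simpa using congrFun h i₀
    rw [← Finset.add_sum_erase _ _ (Finset.mem_univ i₀),
      ← Finset.add_sum_erase _ _ (Finset.mem_univ i₀),
      Finset.sum_congr rfl fun j hj => by rw [hne j (Finset.ne_of_mem_erase hj)],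
      hi₁, one_smul, one_smul] at hsum
    funext j
    by_cases hj : j = i₀
    · rw [hj]
      exact add_right_cancel hsum
    · exact hne j hj

open Classical in
/-- The number of ordered bases does not depend on the half-dimensional space. -/
lemma card_bases_halfSpace {A : Submodule (ZMod 2) (Vec n)} (hA : A ∈ halfSpaces n) :
    ((Finset.univ.filter fun b : Fin (n / 2) → Vec n => LinearIndependent (ZMod 2) b).filter
      fun b => Submodule.span (ZMod 2) (Set.range b) = A).card =
      ∏ i : Fin (n / 2), (2 ^ (n / 2) - 2 ^ i.val) := by
  have hdim := (mem_halfSpaces.1 hA).1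
  have h := card_linearIndependent (K := ZMod 2) (V := A) (k := n / 2) hdim.ge
  rw [ZMod.card, hdim] at h
  rw [← h, Finset.filter_filter, ← Fintype.card_subtype, ← Nat.card_eq_fintype_card]
  refine Nat.card_congr
    { toFun := fun b => ⟨fun i => ⟨b.1 i, ?_⟩, ?_⟩
      invFun := fun s => ⟨fun i => s.1 i, ?_, ?_⟩
      left_inv := fun b => rfl
      right_inv := fun s => rfl }
  · exact b.2.2.le (Submodule.subset_span ⟨i, rfl⟩)
  · exact LinearIndependent.of_comp A.subtype b.2.1
  · exact s.2.map' A.subtype (Submodule.ker_subtype A)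
  · have hli : LinearIndependent (ZMod 2) fun i => (s.1 i : Vec n) :=
      s.2.map' A.subtype (Submodule.ker_subtype A)
    refine Submodule.eq_of_le_of_finrank_eq ?_ ?_
    · rw [Submodule.span_le]
      rintro _ ⟨i, rfl⟩
      exact (s.1 i).2
    · rw [finrank_span_eq_card hli, Fintype.card_fin, hdim]

lemma span_mem_halfSpaces (hn : Even n) {b : Fin (n / 2) → Vec n}
    (hb : LinearIndependent (ZMod 2) b) :
    Submodule.span (ZMod 2) (Set.range b) ∈ halfSpaces n := by
  rw [mem_halfSpaces, finrank_perp, finrank_span_eq_card hb, Fintype.card_fin]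
  obtain ⟨m, rfl⟩ := hn
  omega

open Classical in
lemma card_span_inf_perp_le {m : ℕ} {b : Fin m → Vec n} :
    Nat.card ↥(Submodule.span (ZMod 2) (Set.range b) ⊓
        perp (Submodule.span (ZMod 2) (Set.range b))) ≤
      (Finset.univ.filter fun c : Fin m → ZMod 2 =>
        ∀ j, (∑ i, c i • b i) ⬝ᵥ b j = 0).card := by
  rw [← Fintype.card_subtype, ← Nat.card_eq_fintype_card]
  have hmem : ∀ x : ↥(Submodule.span (ZMod 2) (Set.range b) ⊓
      perp (Submodule.span (ZMod 2) (Set.range b))),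
      ∃ c : Fin m → ZMod 2, ∑ i, c i • b i = x := fun x =>
    (Submodule.mem_span_range_iff_exists_fun (ZMod 2)).1 x.2.1
  choose c hc using hmem
  refine Nat.card_le_card_of_injective
    (fun x => ⟨c x, fun j => ?_⟩) fun x y h => ?_
  · rw [hc]
    exact x.2.2 _ (Submodule.subset_span ⟨j, rfl⟩)
  · have : c x = c y := congrArg Subtype.val h
    apply Subtype.ext
    rw [← hc x, ← hc y, this]

open Classical in
lemma card_tuples_le_two_mul_card_linearIndependent (hn : Even n) (hn0 : 0 < n) :
    (2 ^ n) ^ (n / 2) ≤ 2 * (Finset.univ.filter fun b : Fin (n / 2) → Vec n =>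
      LinearIndependent (ZMod 2) b).card := by
  have h1 := card_not_linearIndepOn_mul_le (V := Vec n) (Finset.univ : Finset (Fin (n / 2)))
  simp only [Finset.coe_univ, linearIndepOn_univ_iff, Finset.card_univ, Fintype.card_fin,
    Fintype.card_fun, ZMod.card] at h1
  have h2 := Finset.card_filter_add_card_filter_not (s := Finset.univ)
    fun b : Fin (n / 2) → Vec n => LinearIndependent (ZMod 2) b
  simp only [Finset.card_univ, Fintype.card_fun, Fintype.card_fin, ZMod.card] at h2
  set B := (Finset.univ.filter fun b : Fin (n / 2) → Vec n => ¬ LinearIndependent (ZMod 2) b).card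
  have h3 : (2 : ℕ) ^ n = 2 ^ (n / 2) * 2 ^ (n / 2) := by
    rw [← pow_add]
    congr 1
    obtain ⟨m, rfl⟩ := hn
    omega
  have h4 : 2 ≤ 2 ^ (n / 2) := by
    have : 1 ≤ n / 2 := by
      obtain ⟨m, rfl⟩ := hn
      omega
    simpa using Nat.pow_le_pow_right two_pos this
  generalize (2 ^ n) ^ (n / 2) = T at h1 h2 ⊢
  rw [h3] at h1
  generalize 2 ^ (n / 2) = P at h1 h4
  have h5 : B * P ≤ T := by
    have h1' : B * (P * P) ≤ P * T := by convert h1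
    refine le_of_mul_le_mul_left ?_ (two_pos.trans_le h4)
    linarith
  have h6 : B * 2 ≤ T := (Nat.mul_le_mul_left _ h4).trans h5
  omega

/-- On average `A ∩ A^⊥` has at most `8` elements. -/
theorem sum_card_inf_perp_le (hn : Even n) (hn0 : 0 < n) :
    0 < (halfSpaces n).card ∧
      ∑ A ∈ halfSpaces n, Nat.card ↥(A ⊓ perp A) ≤ 8 * (halfSpaces n).card := by
  classical
  set T := Finset.univ.filter fun b : Fin (n / 2) → Vec n => LinearIndependent (ZMod 2) b with hT
  set K := ∏ i : Fin (n / 2), (2 ^ (n / 2) - 2 ^ i.val)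
  have hfib : ∀ F : Submodule (ZMod 2) (Vec n) → ℕ,
      ∑ b ∈ T, F (Submodule.span (ZMod 2) (Set.range b)) = K * ∑ A ∈ halfSpaces n, F A := by
    intro F
    have hmaps : ∀ b ∈ T, Submodule.span (ZMod 2) (Set.range b) ∈ halfSpaces n := fun b hb =>
      span_mem_halfSpaces hn (Finset.mem_filter.1 hb).2
    rw [← Finset.sum_fiberwise_of_maps_to hmaps, Finset.mul_sum]
    refine Finset.sum_congr rfl fun A hA => ?_
    rw [Finset.sum_congr rfl fun b hb => by rw [(Finset.mem_filter.1 hb).2], Finset.sum_const,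
      card_bases_halfSpace hA, smul_eq_mul]
  have hcard : T.card = K * (halfSpaces n).card := by
    simpa using hfib fun _ => 1
  have hall := card_tuples_le_two_mul_card_linearIndependent hn hn0
  rw [← hT, hcard] at hall
  have hpos : 0 < (2 ^ n) ^ (n / 2) := by positivity
  have hKh : 0 < K * (halfSpaces n).card := by omega
  have hK : 0 < K := pos_of_mul_pos_left hKh (Nat.zero_le _)
  refine ⟨pos_of_mul_pos_right hKh (Nat.zero_le _), ?_⟩
  refine Nat.le_of_mul_le_mul_left ?_ hK
  rw [← hfib fun A => Nat.card ↥(A ⊓ perp A)]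
  have hexp : 2 ^ (n / 2) * (2 ^ (n * (n / 2 - 1)) + 2 ^ n * 2 ^ ((n - 1) * (n / 2 - 1))) ≤
      3 * (2 ^ n) ^ (n / 2) := by
    obtain ⟨m, rfl⟩ := hn
    obtain ⟨k, rfl⟩ : ∃ k, m = k + 1 := ⟨m - 1, by omega⟩
    have e1 : (k + 1 + (k + 1)) / 2 = k + 1 := by omega
    have e2 : k + 1 + (k + 1) - 1 = 2 * k + 1 := by omega
    rw [e1, e2, Nat.add_sub_cancel, mul_add, ← pow_add, ← pow_add, ← pow_add, ← pow_mul]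
    have e3 : k + 1 + (k + 1 + (k + 1)) * k ≤ (k + 1 + (k + 1)) * (k + 1) := by nlinarith
    have e4 : k + 1 + (k + 1 + (k + 1) + (2 * k + 1) * k) = (k + 1 + (k + 1)) * (k + 1) + 1 := by
      ring
    have e5 := Nat.pow_le_pow_right two_pos e3
    rw [e4, pow_succ]
    omega
  calc _ ≤ ∑ b ∈ T, (Finset.univ.filter fun c : Fin (n / 2) → ZMod 2 =>
          ∀ j, (∑ i, c i • b i) ⬝ᵥ b j = 0).card :=
        Finset.sum_le_sum fun b _ => card_span_inf_perp_le
    _ ≤ ∑ b : Fin (n / 2) → Vec n, (Finset.univ.filter fun c : Fin (n / 2) → ZMod 2 =>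
          ∀ j, (∑ i, c i • b i) ⬝ᵥ b j = 0).card :=
        Finset.sum_le_sum_of_subset (Finset.subset_univ _)
    _ = ∑ c : Fin (n / 2) → ZMod 2, (Finset.univ.filter fun b : Fin (n / 2) → Vec n =>
          ∀ j, (∑ i, c i • b i) ⬝ᵥ b j = 0).card := by
        simp_rw [Finset.card_filter]
        rw [Finset.sum_comm]
    _ ≤ (2 ^ n) ^ (n / 2) + 2 ^ (n / 2) *
          (2 ^ (n * (n / 2 - 1)) + 2 ^ n * 2 ^ ((n - 1) * (n / 2 - 1))) := by
        rw [← Finset.add_sum_erase _ _ (Finset.mem_univ 0)]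
        refine Nat.add_le_add ((Finset.card_le_univ _).trans (by simp)) ?_
        refine (Finset.sum_le_card_nsmul _ _ _ fun c hc =>
          card_combination_orthogonal_le (Finset.ne_of_mem_erase hc)).trans ?_
        rw [smul_eq_mul]
        refine Nat.mul_le_mul_right _ ((Finset.card_le_card (Finset.erase_subset _ _)).trans ?_)
        simp
    _ ≤ K * (8 * (halfSpaces n).card) := by
        have : K * (8 * (halfSpaces n).card) = 8 * (K * (halfSpaces n).card) := by ring
        omega

end HalfSpaces

/-! ### The distribution of the master secret key -/

section Setup

variable {N n t : ℕ}

lemma mem_setupSupport {k : MSK N n t} : k ∈ setupSupport N n t ↔ k.Valid := by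
  simp [setupSupport]

lemma setupExp_mono {f g : MSK N n t → ℝ} (h : ∀ k, k.Valid → f k ≤ g k) :
    setupExp f ≤ setupExp g :=
  div_le_div_of_nonneg_right (Finset.sum_le_sum fun k hk => h k (mem_setupSupport.1 hk))
    (Nat.cast_nonneg _)

lemma setupExp_add (f g : MSK N n t → ℝ) :
    setupExp (fun k => f k + g k) = setupExp f + setupExp g := by
  simp only [setupExp, Finset.sum_add_distrib, add_div]

lemma setupExp_sum {ι : Type*} (s : Finset ι) (f : ι → MSK N n t → ℝ) :
    setupExp (fun k => ∑ i ∈ s, f i k) = ∑ i ∈ s, setupExp (f i) := by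
  simp only [setupExp, Finset.sum_div]
  rw [Finset.sum_comm]

lemma setupExp_nonneg {f : MSK N n t → ℝ} (h : ∀ k, k.Valid → 0 ≤ f k) : 0 ≤ setupExp f :=
  div_nonneg (Finset.sum_nonneg fun k hk => h k (mem_setupSupport.1 hk)) (Nat.cast_nonneg _)

lemma setupExp_const (h : 0 < (setupSupport N n t).card) (c : ℝ) :
    setupExp (fun _ : MSK N n t => c) = c := by
  have : ((setupSupport N n t).card : ℝ) ≠ 0 := by exact_mod_cast h.ne'
  rw [setupExp, Finset.sum_const, nsmul_eq_mul]
  field_simp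

lemma setupProb_nonneg (E : MSK N n t → Prop) : 0 ≤ setupProb E :=
  setupExp_nonneg fun k _ => by split_ifs <;> simp

lemma setupProb_mono {E F : MSK N n t → Prop} (h : ∀ k, k.Valid → E k → F k) :
    setupProb E ≤ setupProb F := by
  refine setupExp_mono fun k hk => ?_
  by_cases hE : E k
  · rw [if_pos hE, if_pos (h k hk hE)]
  · rw [if_neg hE]
    split_ifs <;> simp

lemma setupProb_or_le (E F : MSK N n t → Prop) :
    setupProb (fun k => E k ∨ F k) ≤ setupProb E + setupProb F := by
  rw [setupProb, setupProb, setupProb, ← setupExp_add]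
  refine setupExp_mono fun k _ => ?_
  by_cases hE : E k <;> by_cases hF : F k <;> simp [hE, hF]

open Classical in
lemma setupProb_exists_le {ι : Type*} [Fintype ι] (E : ι → MSK N n t → Prop) :
    setupProb (fun k => ∃ i, E i k) ≤ ∑ i, setupProb (E i) := by
  unfold setupProb
  rw [← setupExp_sum]
  refine setupExp_mono fun k _ => ?_
  have h0 : ∀ i ∈ Finset.univ, (0 : ℝ) ≤ if E i k then 1 else 0 := fun i _ => by
    split_ifs <;> simp
  split_ifs with h
  · obtain ⟨i, hi⟩ := h
    calc (1 : ℝ) = if E i k then 1 else 0 := by rw [if_pos hi]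
      _ ≤ _ := Finset.single_le_sum h0 (Finset.mem_univ i)
  · exact Finset.sum_nonneg h0

lemma one_sub_setupProb (h : 0 < (setupSupport N n t).card) (E : MSK N n t → Prop) :
    1 - setupProb E = setupProb fun k => ¬ E k := by
  rw [sub_eq_iff_eq_add, setupProb, setupProb, ← setupExp_add]
  refine (setupExp_const h 1).symm.trans (congrArg _ (funext fun k => ?_))
  by_cases hE : E k <;> simp [hE]

/-- The exchange of the roles of `A` and `A^⊥`. -/
def MSK.swap (k : MSK N n t) : MSK N n t where
  A := perp k.A
  v := k.w
  w := k.v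
  idxV := k.idxW
  idxW := k.idxV

lemma MSK.swap_swap (k : MSK N n t) : k.swap.swap = k := by
  ext1 <;> simp [MSK.swap, perp_perp]

lemma MSK.Valid.swap {k : MSK N n t} (h : k.Valid) : k.swap.Valid :=
  ⟨h.2.1, (congrArg (fun A : Submodule (ZMod 2) (Vec n) => Module.finrank (ZMod 2) A)
    (perp_perp k.A)).trans h.1, h.2.2.2, fun i => (perp_perp k.A).ge (h.2.2.1 i)⟩

lemma setupExp_swap (f : MSK N n t → ℝ) : setupExp (fun k => f k.swap) = setupExp f := by
  unfold setupExp
  congr 1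
  exact Finset.sum_nbij' MSK.swap MSK.swap
    (fun k hk => mem_setupSupport.2 (mem_setupSupport.1 hk).swap)
    (fun k hk => mem_setupSupport.2 (mem_setupSupport.1 hk).swap)
    (fun k _ => k.swap_swap) (fun k _ => k.swap_swap) fun k _ => rfl

open Classical in
lemma setupProb_swap (E : MSK N n t → Prop) : setupProb (fun k => E k.swap) = setupProb E :=
  setupExp_swap fun k => if E k then 1 else 0

open Classical in
/-- Summation over the keys one component at a time. -/
lemma sum_setupSupport (f : MSK N n t → ℝ) :
    ∑ k ∈ setupSupport N n t, f k =
      ∑ A ∈ halfSpaces n, ∑ w : Fin (n / 2) → perp A, ∑ iW : Fin N → Fin t → Fin (n / 2),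
        ∑ v : Fin (n / 2) → A, ∑ iV : Fin N → Fin t → Fin (n / 2),
          f ⟨A, fun i => v i, fun j => w j, iV, iW⟩ := by
  symm
  simp_rw [← Fintype.sum_prod_type', Finset.sum_sigma']
  refine Finset.sum_nbij (fun p => ⟨p.1, fun i => p.2.2.2.1 i, fun j => p.2.1 j, p.2.2.2.2,
    p.2.2.1⟩) ?_ ?_ ?_ ?_
  · rintro ⟨A, w, iW, v, iV⟩ h
    have hA := mem_halfSpaces.1 (Finset.mem_sigma.1 h).1
    exact mem_setupSupport.2 ⟨hA.1, hA.2, fun i => (v i).2, fun j => (w j).2⟩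
  · rintro ⟨A, w, iW, v, iV⟩ - ⟨A', w', iW', v', iV'⟩ - h
    simp only [MSK.mk.injEq] at h
    obtain ⟨rfl, hv, hw, rfl, rfl⟩ := h
    obtain rfl : v = v' := funext fun i => Subtype.ext (congrFun hv i)
    obtain rfl : w = w' := funext fun i => Subtype.ext (congrFun hw i)
    rfl
  · rintro ⟨A, v, w, iV, iW⟩ hk
    obtain ⟨h1, h2, hv, hw⟩ := mem_setupSupport.1 hk
    exact ⟨⟨A, fun j => ⟨w j, hw j⟩, iW, fun i => ⟨v i, hv i⟩, iV⟩,
      Finset.mem_coe.2 (Finset.mem_sigma.2 ⟨mem_halfSpaces.2 ⟨h1, h2⟩, Finset.mem_univ _⟩), rfl⟩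
  · intro p _
    rfl

open Classical in
/-- The number of keys with a given half-dimensional space does not depend on the space. -/
lemma card_completions {A : Submodule (ZMod 2) (Vec n)} (hA : A ∈ halfSpaces n) :
    (Fintype.card (Fin (n / 2) → perp A) * Fintype.card (Fin N → Fin t → Fin (n / 2)) *
      (Fintype.card (Fin (n / 2) → A) * Fintype.card (Fin N → Fin t → Fin (n / 2))) : ℕ) =
      ((2 ^ (n / 2)) ^ (n / 2) * ((n / 2) ^ t) ^ N) ^ 2 := by
  obtain ⟨h1, h2⟩ := mem_halfSpaces.1 hA
  have h3 := natCard_submodule A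
  have h4 := natCard_submodule (perp A)
  rw [h1, Nat.card_eq_fintype_card] at h3
  rw [h2, Nat.card_eq_fintype_card] at h4
  simp only [Fintype.card_fun, Fintype.card_fin, h3, h4]
  ring

open Classical in
lemma card_setupSupport : (setupSupport N n t).card =
    (halfSpaces n).card * ((2 ^ (n / 2)) ^ (n / 2) * ((n / 2) ^ t) ^ N) ^ 2 := by
  have h : ((setupSupport N n t).card : ℝ) = ∑ k ∈ setupSupport N n t, (1 : ℝ) := by simp
  rw [sum_setupSupport] at h
  rw [← @Nat.cast_inj ℝ, h, Nat.cast_mul, ← nsmul_eq_mul, ← Finset.sum_const]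
  refine Finset.sum_congr rfl fun A hA => ?_
  rw [← card_completions (N := N) (t := t) hA]
  simp only [Finset.sum_const, Finset.card_univ, nsmul_eq_mul, mul_one]
  push_cast
  ring

lemma setupSupport_card_pos (hn : Even n) (hn0 : 0 < n) : 0 < (setupSupport N n t).card := by
  rw [card_setupSupport]
  have h1 := (sum_card_inf_perp_le hn hn0).1
  have h2 : 0 < n / 2 := by
    obtain ⟨m, rfl⟩ := hn
    omega
  positivity

open Classical in
/-- A bound that holds on average over the `v_i` and the index lists of the sets `I_id`, for all
choices of the other components. -/
lemma setupExp_le_of_forall {f : MSK N n t → ℝ} {ε : ℝ} (hε : 0 ≤ ε)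
    (h : ∀ A ∈ halfSpaces n, ∀ (w : Fin (n / 2) → perp A) (iW : Fin N → Fin t → Fin (n / 2)),
      ∑ v : Fin (n / 2) → A, ∑ iV : Fin N → Fin t → Fin (n / 2),
        f ⟨A, fun i => v i, fun j => w j, iV, iW⟩ ≤
        ε * (Fintype.card (Fin (n / 2) → A) * Fintype.card (Fin N → Fin t → Fin (n / 2)))) :
    setupExp f ≤ ε := by
  refine div_le_of_le_mul₀ (Nat.cast_nonneg _) hε ?_
  have hc : ((setupSupport N n t).card : ℝ) = ∑ k ∈ setupSupport N n t, (1 : ℝ) := by simp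
  rw [hc, sum_setupSupport, sum_setupSupport, Finset.mul_sum]
  refine Finset.sum_le_sum fun A hA => ?_
  rw [Finset.mul_sum]
  refine Finset.sum_le_sum fun w _ => ?_
  rw [Finset.mul_sum]
  refine Finset.sum_le_sum fun iW _ => (h A hA w iW).trans (le_of_eq ?_)
  simp

open Classical in
/-- Large intersections of `A` with `A^⊥` are rare, by Markov's inequality. -/
theorem setupProb_lt_finrank_inf_perp_le (hn : Even n) (hn0 : 0 < n) (r : ℝ) :
    setupProb (fun k : MSK N n t => r < Module.finrank (ZMod 2) ↥(k.A ⊓ perp k.A)) ≤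
      8 * 2 ^ (-r) := by
  have hmarkov : ∀ k : MSK N n t, (r < Module.finrank (ZMod 2) ↥(k.A ⊓ perp k.A)) →
      (1 : ℝ) ≤ Nat.card ↥(k.A ⊓ perp k.A) * 2 ^ (-r) := by
    intro k hk
    rw [natCard_submodule, Nat.cast_pow, Nat.cast_two, ← Real.rpow_natCast,
      ← Real.rpow_add two_pos]
    exact Real.one_le_rpow one_le_two (by linarith)
  calc _ ≤ setupExp fun k : MSK N n t => (Nat.card ↥(k.A ⊓ perp k.A) * 2 ^ (-r) : ℝ) := by
        refine setupExp_mono fun k _ => ?_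
        split_ifs with h
        · exact hmarkov k h
        · positivity
    _ ≤ 8 * 2 ^ (-r) := by
        refine div_le_of_le_mul₀ (Nat.cast_nonneg _) (by positivity) ?_
        rw [sum_setupSupport, card_setupSupport]
        set K := ((2 ^ (n / 2)) ^ (n / 2) * ((n / 2) ^ t) ^ N) ^ 2 with hK
        have h1 : ∀ A ∈ halfSpaces n, (∑ _w : Fin (n / 2) → perp A,
            ∑ _iW : Fin N → Fin t → Fin (n / 2), ∑ _v : Fin (n / 2) → A,
              ∑ _iV : Fin N → Fin t → Fin (n / 2), (Nat.card ↥(A ⊓ perp A) * 2 ^ (-r) : ℝ)) =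
            K * 2 ^ (-r) * Nat.card ↥(A ⊓ perp A) := by
          intro A hA
          rw [hK, ← card_completions (N := N) (t := t) hA]
          simp only [Finset.sum_const, Finset.card_univ, nsmul_eq_mul]
          push_cast
          ring
        rw [Finset.sum_congr rfl h1, ← Finset.mul_sum]
        have h2 : (∑ A ∈ halfSpaces n, (Nat.card ↥(A ⊓ perp A) : ℝ)) ≤ 8 * (halfSpaces n).card := by
          exact_mod_cast (sum_card_inf_perp_le hn hn0).2
        calc _ ≤ (K : ℝ) * 2 ^ (-r) * (8 * (halfSpaces n).card) := by gcongr
          _ = _ := by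
            push_cast
            ring

end Setup

/-! ### Good keys are overwhelmingly likely -/

section Good

variable {N n t : ℕ}

open Classical in
/-- The indices listed for the last `C` identities. -/
noncomputable def advIndices (n t : ℕ) {m : ℕ} (iV : Fin N → Fin t → Fin m) : Finset (Fin m) :=
  (Finset.univ.filter fun id : Fin N => honestCount N n t ≤ id.val).biUnion
    fun id => Finset.univ.image (iV id)

lemma four_mul_card_advIndices_le {m : ℕ} (iV : Fin N → Fin t → Fin m) :
    4 * (advIndices n t iV).card ≤ n := by
  classical
  have h1 : (Finset.univ.filter fun id : Fin N => honestCount N n t ≤ id.val).card ≤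
      collusionBound n t := by
    refine (Finset.card_le_card_of_injOn (t := Finset.range (collusionBound n t))
      (fun id => id.val - honestCount N n t) ?_ ?_).trans (Finset.card_range _).le
    · intro id hid
      have := (Finset.mem_filter.1 (Finset.mem_coe.1 hid)).2
      have h2 := id.2
      simp only [Finset.coe_range, Set.mem_Iio]
      unfold honestCount at *
      omega
    · intro id hid id' hid' h
      have h1 := (Finset.mem_filter.1 (Finset.mem_coe.1 hid)).2
      have h2 := (Finset.mem_filter.1 (Finset.mem_coe.1 hid')).2
      dsimp only at h
      exact Fin.ext (by omega)
  have h2 : (advIndices n t iV).card ≤ collusionBound n t * t := by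
    refine (Finset.card_biUnion_le_card_mul _ _ t fun id _ => ?_).trans
      (Nat.mul_le_mul_right _ h1)
    exact Finset.card_image_le.trans (by simp)
  have h3 : n / (4 * t) * (4 * t) ≤ n := Nat.div_mul_le_self _ _
  unfold collusionBound at h2
  nlinarith

/-- If the vectors of the adversary and of a verifier are linearly independent, the verifier
contributes one dimension for each new index. -/
lemma finrank_span_image_add_card_sdiff {ι V : Type*} [DecidableEq ι] [AddCommGroup V]
    [Module (ZMod 2) V] [Module.Finite (ZMod 2) V] {v : ι → V} {S R : Finset ι}
    (h : LinearIndepOn (ZMod 2) v (↑(S ∪ R) : Set ι)) :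
    Module.finrank (ZMod 2) (Submodule.span (ZMod 2) (v '' S)) + (R \ S).card =
      Module.finrank (ZMod 2)
        ↥(Submodule.span (ZMod 2) (v '' S) ⊔ Submodule.span (ZMod 2) (v '' R)) := by
  have hfin : ∀ T : Finset ι, T ⊆ S ∪ R →
      Module.finrank (ZMod 2) (Submodule.span (ZMod 2) (v '' T)) = T.card := by
    intro T hT
    have h1 : LinearIndepOn (ZMod 2) v (T : Set ι) := h.mono (Finset.coe_subset.2 hT)
    have h2 := finrank_span_eq_card h1
    rw [Set.image_eq_range]
    exact h2.trans (Fintype.card_coe T)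
  rw [← Submodule.span_union, ← Set.image_union, ← Finset.coe_union, hfin _ subset_rfl,
    hfin _ Finset.subset_union_left, ← Finset.card_union_of_disjoint Finset.disjoint_sdiff,
    Finset.union_sdiff_self_eq_union]

/-- The verifier `id` adds at least `t / 4` dimensions to `V_adv`. -/
def MSK.GoodV (k : MSK N n t) (id : Fin (honestCount N n t)) : Prop :=
  (Module.finrank (ZMod 2) k.Vadv : ℝ) + (t : ℝ) / 4 ≤
    Module.finrank (ZMod 2) ↥(k.Vadv ⊔ k.V (honest id))

lemma MSK.good_iff (k : MSK N n t) : k.Good ↔ ∀ id, k.GoodV id ∧ k.swap.GoodV id := Iff.rfl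

open Classical in
lemma MSK.goodV_of_linearIndepOn {k : MSK N n t} {id : Fin (honestCount N n t)}
    (h1 : t ≤ 4 * (Finset.univ.image (k.idxV (honest id)) \ advIndices n t k.idxV).card)
    (h2 : LinearIndepOn (ZMod 2) k.v
      (↑(advIndices n t k.idxV ∪ Finset.univ.image (k.idxV (honest id))) : Set (Fin (n / 2)))) :
    k.GoodV id := by
  have h3 := finrank_span_image_add_card_sdiff h2
  have h4 : (↑(advIndices n t k.idxV) : Set (Fin (n / 2))) = k.Iadv := by
    ext i
    simp [advIndices, MSK.Iadv, MSK.I]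
  have h5 : (↑(Finset.univ.image (k.idxV (honest id))) : Set (Fin (n / 2))) = k.I (honest id) := by
    simp [MSK.I]
  rw [h4, h5] at h3
  unfold MSK.GoodV MSK.Vadv MSK.V
  rw [← h3]
  have h6 : (t : ℝ) ≤ 4 * (Finset.univ.image (k.idxV (honest id)) \
      advIndices n t k.idxV).card := by exact_mod_cast h1
  push_cast
  linarith

open Classical in
/-- A fixed verifier rarely has fewer than `t / 4` indices that the adversary lacks. -/
lemma card_few_new_indices_verifier_le (id : Fin (honestCount N n t)) :
    ((Finset.univ.filter fun iV : Fin N → Fin t → Fin (n / 2) =>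
      4 * (Finset.univ.image (iV (MSK.honest id)) \ advIndices n t iV).card < t).card : ℝ) *
        ((n / 2 : ℕ) : ℝ) ^ t ≤
      (6 / 5 * (3 / 4 * (n / 2 : ℕ) + t / 2) : ℝ) ^ t *
        Fintype.card (Fin N → Fin t → Fin (n / 2)) := by
  set j₀ : Fin N := MSK.honest id
  have hj₀ : ¬ honestCount N n t ≤ j₀.val := not_le.2 id.2
  set e := Equiv.funSplitAt j₀ (Fin t → Fin (n / 2))
  -- The adversary's indices depend on the lists of the other identities only.
  have hadv : ∀ (y y' : Fin t → Fin (n / 2)) (r : {j // j ≠ j₀} → Fin t → Fin (n / 2)),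
      advIndices n t (e.symm (y, r)) = advIndices n t (e.symm (y', r)) := by
    intro y y' r
    unfold advIndices
    refine Finset.biUnion_congr rfl fun j hj => ?_
    have hne : j ≠ j₀ := fun h => hj₀ (h ▸ (Finset.mem_filter.1 hj).2)
    simp [e, hne]
  have hself : ∀ y r, e.symm (y, r) j₀ = y := fun y r => by simp [e]
  have hfix : ∀ r : {j // j ≠ j₀} → Fin t → Fin (n / 2),
      (∑ y, if 4 * (Finset.univ.image (e.symm (y, r) j₀) \
        advIndices n t (e.symm (y, r))).card < t then (1 : ℝ) else 0) ≤
      (6 / 5 * (3 / 4 * (n / 2 : ℕ) + t / 2) : ℝ) ^ t := by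
    intro r
    rcases isEmpty_or_nonempty (Fin t → Fin (n / 2)) with hemp | ⟨⟨y₀⟩⟩
    · rw [Finset.univ_eq_empty, Finset.sum_empty]
      positivity
    · have hS : 2 * (advIndices n t (e.symm (y₀, r))).card ≤ n / 2 := by
        have := four_mul_card_advIndices_le (n := n) (e.symm (y₀, r))
        omega
      refine le_trans (le_of_eq ?_) (card_few_new_indices_le _ hS)
      rw [Finset.card_filter, Nat.cast_sum]
      refine Finset.sum_congr rfl fun y _ => ?_
      rw [hself, hadv y y₀ r, Nat.cast_ite, Nat.cast_one, Nat.cast_zero]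
  have hcard : (Fintype.card (Fin N → Fin t → Fin (n / 2)) : ℝ) =
      Fintype.card ({j // j ≠ j₀} → Fin t → Fin (n / 2)) * ((n / 2 : ℕ) : ℝ) ^ t := by
    rw [Fintype.card_congr e, Fintype.card_prod, mul_comm]
    simp
  rw [hcard, ← mul_assoc]
  refine mul_le_mul_of_nonneg_right ?_ (by positivity)
  rw [Finset.card_filter, Nat.cast_sum, ← e.symm.sum_comp, Fintype.sum_prod_type_right]
  simp only [Nat.cast_ite, Nat.cast_one, Nat.cast_zero]
  refine (Finset.sum_le_sum fun r _ => hfix r).trans (le_of_eq ?_)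
  rw [Finset.sum_const, Finset.card_univ, nsmul_eq_mul, mul_comm]

open Classical in
lemma card_dependent_vectors_le (A : Submodule (ZMod 2) (Vec n)) (hA : A ∈ halfSpaces n)
    (D : Finset (Fin (n / 2))) (hD : D.card ≤ n / 4 + t) :
    ((Finset.univ.filter fun v : Fin (n / 2) → A =>
      ¬ LinearIndepOn (ZMod 2) (fun i => (v i : Vec n)) (D : Set (Fin (n / 2)))).card : ℝ) ≤
      2 ^ (n / 4 + t) / 2 ^ (n / 2) * Fintype.card (Fin (n / 2) → A) := by
  have h1 : (Finset.univ.filter fun v : Fin (n / 2) → A =>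
      ¬ LinearIndepOn (ZMod 2) v (D : Set (Fin (n / 2)))).card * Fintype.card A ≤
      2 ^ D.card * Fintype.card A ^ Fintype.card (Fin (n / 2)) := by
    convert card_not_linearIndepOn_mul_le (V := A) D
  have h2 := natCard_submodule A
  rw [(mem_halfSpaces.1 hA).1, Nat.card_eq_fintype_card] at h2
  have h3 : (Finset.univ.filter fun v : Fin (n / 2) → A =>
      ¬ LinearIndepOn (ZMod 2) (fun i => (v i : Vec n)) (D : Set (Fin (n / 2)))) =
      Finset.univ.filter fun v : Fin (n / 2) → A =>
        ¬ LinearIndepOn (ZMod 2) v (D : Set (Fin (n / 2))) := by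
    refine Finset.filter_congr fun v _ => not_congr ?_
    exact LinearMap.linearIndependent_iff A.subtype (Submodule.ker_subtype A)
  rw [h3, div_mul_eq_mul_div, le_div_iff₀ (by positivity)]
  have h4 := h1.trans (Nat.mul_le_mul_right _ (Nat.pow_le_pow_right two_pos hD))
  rw [h2, ← h2, ← Fintype.card_fun, h2] at h4
  generalize Fintype.card (Fin (n / 2) → A) = Y at h4 ⊢
  generalize Finset.card _ = X at h4 ⊢
  exact_mod_cast h4

open Classical in
/-- The failure probability for a single verifier: too few new indices, or linearly dependent
vectors. -/
theorem setupProb_not_goodV_le (hn : Even n) (hn0 : 0 < n) (id : Fin (honestCount N n t)) :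
    setupProb (fun k : MSK N n t => ¬ k.GoodV id) ≤
      (6 / 5 * (3 / 4 + t / n) : ℝ) ^ t + 2 ^ (n / 4 + t) / 2 ^ (n / 2) := by
  refine setupExp_le_of_forall (by positivity) fun A hA w iW => ?_
  set P : (Fin N → Fin t → Fin (n / 2)) → Prop := fun iV =>
    4 * (Finset.univ.image (iV (MSK.honest id)) \ advIndices n t iV).card < t with hP
  set Q : (Fin (n / 2) → A) → (Fin N → Fin t → Fin (n / 2)) → Prop := fun v iV =>
    ¬ LinearIndepOn (ZMod 2) (fun i => (v i : Vec n))
      (↑(advIndices n t iV ∪ Finset.univ.image (iV (MSK.honest id))) : Set (Fin (n / 2))) with hQ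
  set ε₁ : ℝ := (6 / 5 * (3 / 4 + t / n) : ℝ) ^ t with hε₁
  set ε₂ : ℝ := 2 ^ (n / 4 + t) / 2 ^ (n / 2) with hε₂
  have hm : 0 < n / 2 := by
    obtain ⟨m, rfl⟩ := hn
    omega
  have hmR : (0 : ℝ) < (n / 2 : ℕ) := by exact_mod_cast hm
  have hnR : (n : ℝ) = 2 * (n / 2 : ℕ) := by exact_mod_cast (Nat.two_mul_div_two_of_even hn).symm
  have h1 : ((Finset.univ.filter P).card : ℝ) ≤
      ε₁ * Fintype.card (Fin N → Fin t → Fin (n / 2)) := by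
    have h := card_few_new_indices_verifier_le (n := n) id
    have h' : (6 / 5 * (3 / 4 * (n / 2 : ℕ) + t / 2) : ℝ) ^ t =
        ε₁ * ((n / 2 : ℕ) : ℝ) ^ t := by
      rw [hε₁, ← mul_pow, hnR]
      congr 1
      field_simp
    rw [h', mul_right_comm] at h
    exact le_of_mul_le_mul_right h (by positivity)
  have h2 : ∀ iV, ((Finset.univ.filter fun v => Q v iV).card : ℝ) ≤
      ε₂ * Fintype.card (Fin (n / 2) → A) := by
    intro iV
    refine card_dependent_vectors_le A hA _ ((Finset.card_union_le _ _).trans ?_)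
    refine Nat.add_le_add ?_ (Finset.card_image_le.trans (by simp))
    have := four_mul_card_advIndices_le (n := n) iV
    omega
  calc _ ≤ ∑ v : Fin (n / 2) → A, ∑ iV : Fin N → Fin t → Fin (n / 2),
        ((if P iV then (1 : ℝ) else 0) + if Q v iV then 1 else 0) := by
        refine Finset.sum_le_sum fun v _ => Finset.sum_le_sum fun iV _ => ?_
        by_cases hp : P iV
        · rw [if_pos hp]
          split_ifs <;> norm_num
        · by_cases hq : Q v iV
          · rw [if_pos hq, if_neg hp]
            split_ifs <;> norm_num
          · have hgood : MSK.GoodV (⟨A, fun i => v i, fun j => w j, iV, iW⟩ : MSK N n t) id :=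
              MSK.goodV_of_linearIndepOn (not_lt.1 hp) (not_not.1 hq)
            rw [if_neg (not_not.2 hgood), if_neg hp, if_neg hq, add_zero]
    _ = Fintype.card (Fin (n / 2) → A) * ((Finset.univ.filter P).card : ℝ) +
          ∑ iV, ((Finset.univ.filter fun v => Q v iV).card : ℝ) := by
        simp_rw [Finset.sum_add_distrib]
        congr 1
        · rw [Finset.sum_const, Finset.card_univ, nsmul_eq_mul, Finset.card_filter]
          push_cast
          rfl
        · rw [Finset.sum_comm]
          refine Finset.sum_congr rfl fun iV _ => ?_
          rw [Finset.card_filter]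
          push_cast
          rfl
    _ ≤ Fintype.card (Fin (n / 2) → A) * (ε₁ * Fintype.card (Fin N → Fin t → Fin (n / 2))) +
          ∑ _iV : Fin N → Fin t → Fin (n / 2), ε₂ * Fintype.card (Fin (n / 2) → A) := by
        gcongr with iV
        exact h2 iV
    _ = _ := by
        rw [Finset.sum_const, Finset.card_univ, nsmul_eq_mul]
        ring

/-- The failure probability of `Setup`, by the union bound over the verifiers. -/
theorem setupProb_not_good_le (hn : Even n) (hn0 : 0 < n) :
    setupProb (fun k : MSK N n t => ¬ k.Good) ≤
      2 * N * ((6 / 5 * (3 / 4 + t / n) : ℝ) ^ t + 2 ^ (n / 4 + t) / 2 ^ (n / 2)) := by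
  set ε : ℝ := (6 / 5 * (3 / 4 + t / n) : ℝ) ^ t + 2 ^ (n / 4 + t) / 2 ^ (n / 2) with hε
  have hε0 : 0 ≤ ε := by positivity
  have h1 : setupProb (fun k : MSK N n t => ¬ k.Good) ≤
      setupProb fun k : MSK N n t => ∃ id, (¬ k.GoodV id ∨ ¬ k.swap.GoodV id) := by
    refine setupProb_mono fun k _ h => ?_
    rw [MSK.good_iff] at h
    push Not at h
    obtain ⟨id, hid⟩ := h
    exact ⟨id, not_and_or.1 fun h => hid h.1 h.2⟩
  have h2 : ∀ id, setupProb (fun k : MSK N n t => ¬ k.GoodV id ∨ ¬ k.swap.GoodV id) ≤ 2 * ε := by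
    intro id
    refine (setupProb_or_le _ _).trans ?_
    have h3 : setupProb (fun k : MSK N n t => ¬ k.swap.GoodV id) =
        setupProb fun k : MSK N n t => ¬ k.GoodV id :=
      setupProb_swap fun k => ¬ k.GoodV id
    have h4 := setupProb_not_goodV_le hn hn0 id
    rw [h3]
    linarith
  calc _ ≤ ∑ _id : Fin (honestCount N n t), 2 * ε :=
        (h1.trans (setupProb_exists_le _)).trans (Finset.sum_le_sum fun id _ => h2 id)
    _ = (honestCount N n t : ℝ) * (2 * ε) := by simp
    _ ≤ N * (2 * ε) := by
        gcongr
        exact Nat.sub_le _ _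
    _ = _ := by ring

end Good

/-! ### Asymptotics -/

section Asymptotic

lemma Negligible.of_le {f g : ℕ → ℝ} (hg : Negligible g) (h0 : ∀ᶠ κ in atTop, 0 ≤ f κ)
    (h : ∀ᶠ κ in atTop, f κ ≤ g κ) : Negligible f := by
  refine SuperpolynomialDecay.trans_eventually_abs_le hg ?_
  filter_upwards [h0, h] with κ h0 h
  simp only [Function.comp_apply]
  rw [abs_of_nonneg h0, abs_of_nonneg (h0.trans h)]
  exact h

lemma Negligible.add {f g : ℕ → ℝ} (hf : Negligible f) (hg : Negligible g) :
    Negligible fun κ => f κ + g κ :=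
  SuperpolynomialDecay.add hf hg

lemma Negligible.const_mul {f : ℕ → ℝ} (hf : Negligible f) (c : ℝ) : Negligible fun κ => c * f κ :=
  SuperpolynomialDecay.const_mul hf c

lemma Negligible.polynomial_mul {f : ℕ → ℝ} (hf : Negligible f) (p : Polynomial ℕ) :
    Negligible fun κ => ((p.eval κ : ℕ) : ℝ) * f κ := by
  refine (SuperpolynomialDecay.polynomial_mul hf (p.map (Nat.castRingHom ℝ))).congr fun κ => ?_
  rw [Polynomial.eval_natCast_map, eq_natCast, Nat.cast_id]

lemma negligible_exp_neg_mul_sqrt {b : ℝ} (hb : 0 < b) :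
    Negligible fun κ => Real.exp (-(b * √κ)) := by
  intro k
  have h1 : Tendsto (fun κ : ℕ => b * √(κ : ℝ)) atTop atTop :=
    (Real.tendsto_sqrt_atTop.comp tendsto_natCast_atTop_atTop).const_mul_atTop hb
  have h2 := ((Real.tendsto_pow_mul_exp_neg_atTop_nhds_zero (2 * k)).comp h1).const_mul
    ((b ^ (2 * k))⁻¹)
  rw [mul_zero] at h2
  refine h2.congr fun κ => ?_
  have h3 : √(κ : ℝ) ^ 2 = κ := Real.sq_sqrt (Nat.cast_nonneg _)
  simp only [Function.comp_apply]
  rw [mul_pow, pow_mul √(κ : ℝ), h3]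
  field_simp

lemma Negligible.tendsto_zero {f : ℕ → ℝ} (hf : Negligible f) :
    Tendsto f atTop (nhds 0) := by
  simpa using hf 0

variable {n t : ℕ → ℕ}

lemma tendsto_natCast_of_isBigO (hn : (fun κ : ℕ => (κ : ℝ)) =O[atTop] fun κ => (n κ : ℝ)) :
    Tendsto (fun κ => (n κ : ℝ)) atTop atTop := by
  obtain ⟨K, hK, h⟩ := hn.exists_pos
  refine tendsto_atTop_mono' atTop (f₁ := fun κ : ℕ => K⁻¹ * (κ : ℝ)) ?_
    (tendsto_natCast_atTop_atTop.const_mul_atTop (inv_pos.2 hK))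
  filter_upwards [h.bound] with κ hκ
  simp only [Real.norm_natCast] at hκ
  rw [inv_mul_le_iff₀ hK]
  exact hκ

lemma exists_mul_sqrt_le (ht : (fun κ : ℕ => (t κ : ℝ)) =Θ[atTop] fun κ => √(n κ : ℝ)) :
    ∃ a > 0, ∀ᶠ κ in atTop, a * √(n κ : ℝ) ≤ t κ := by
  obtain ⟨K, hK, h⟩ := ht.2.exists_pos
  refine ⟨K⁻¹, inv_pos.2 hK, ?_⟩
  filter_upwards [h.bound] with κ hκ
  rw [Real.norm_natCast, Real.norm_of_nonneg (Real.sqrt_nonneg _)] at hκ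
  rw [inv_mul_le_iff₀ hK]
  exact hκ

/-- Since `t` grows at least as fast as the square root of the security parameter, every
exponential in `-t` is negligible. -/
lemma negligible_exp_neg_mul (hn : (fun κ : ℕ => (κ : ℝ)) =O[atTop] fun κ => (n κ : ℝ))
    (ht : (fun κ : ℕ => (t κ : ℝ)) =Θ[atTop] fun κ => √(n κ : ℝ)) {b : ℝ} (hb : 0 < b) :
    Negligible fun κ => Real.exp (-(b * t κ)) := by
  obtain ⟨a, ha, hat⟩ := exists_mul_sqrt_le ht
  obtain ⟨K, hK, h⟩ := hn.exists_pos
  refine (negligible_exp_neg_mul_sqrt (b := b * (a * (√K)⁻¹)) (by positivity)).of_le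
    (Eventually.of_forall fun κ => (Real.exp_pos _).le) ?_
  filter_upwards [hat, h.bound] with κ h1 h2
  simp only [Real.norm_natCast] at h2
  refine Real.exp_le_exp.2 (neg_le_neg ?_)
  rw [mul_assoc, mul_assoc]
  refine mul_le_mul_of_nonneg_left (le_trans (mul_le_mul_of_nonneg_left ?_ ha.le) h1) hb.le
  rw [inv_mul_le_iff₀ (Real.sqrt_pos.2 hK), ← Real.sqrt_mul hK.le]
  exact Real.sqrt_le_sqrt h2

lemma tendsto_div_zero (hn : (fun κ : ℕ => (κ : ℝ)) =O[atTop] fun κ => (n κ : ℝ))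
    (ht : (fun κ : ℕ => (t κ : ℝ)) =Θ[atTop] fun κ => √(n κ : ℝ)) :
    Tendsto (fun κ => (t κ : ℝ) / n κ) atTop (nhds 0) := by
  have hninf := tendsto_natCast_of_isBigO hn
  have h1 : (fun κ => √(n κ : ℝ)) =o[atTop] fun κ => (n κ : ℝ) := by
    rw [isLittleO_iff_tendsto']
    · refine (tendsto_inv_atTop_zero.comp (Real.tendsto_sqrt_atTop.comp hninf)).congr fun κ => ?_
      simp only [Function.comp_apply, Real.sqrt_div_self]
    · filter_upwards [hninf.eventually_gt_atTop 0] with κ hκ h0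
      exact absurd h0 hκ.ne'
  exact (ht.1.trans_isLittleO h1).tendsto_div_nhds_zero

lemma eventually_rpow_third_le (hn : (fun κ : ℕ => (κ : ℝ)) =O[atTop] fun κ => (n κ : ℝ))
    (ht : (fun κ : ℕ => (t κ : ℝ)) =Θ[atTop] fun κ => √(n κ : ℝ)) (c : ℝ) :
    ∀ᶠ κ in atTop, c * (n κ : ℝ) ^ (1 / 3 : ℝ) ≤ t κ := by
  obtain ⟨a, ha, hat⟩ := exists_mul_sqrt_le ht
  have h1 := (tendsto_rpow_atTop (show (0 : ℝ) < 1 / 6 by norm_num)).comp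
    (tendsto_natCast_of_isBigO hn)
  filter_upwards [hat, h1.eventually_ge_atTop (c / a),
    (tendsto_natCast_of_isBigO hn).eventually_gt_atTop 0] with κ h2 h3 h4
  refine le_trans ?_ h2
  have h5 : √(n κ : ℝ) = (n κ : ℝ) ^ (1 / 6 : ℝ) * (n κ : ℝ) ^ (1 / 3 : ℝ) := by
    rw [Real.sqrt_eq_rpow, ← Real.rpow_add h4]
    norm_num
  rw [h5, ← mul_assoc]
  refine mul_le_mul_of_nonneg_right ?_ (by positivity)
  rw [Function.comp_apply, div_le_iff₀ ha] at h3
  linarith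

variable {N : ℕ → ℕ}

lemma eventually_pos_of_isBigO
    (hn : (fun κ : ℕ => (κ : ℝ)) =O[atTop] fun κ => (n κ : ℝ)) : ∀ᶠ κ in atTop, 0 < n κ := by
  filter_upwards [(tendsto_natCast_of_isBigO hn).eventually_gt_atTop 0] with κ hκ
  exact_mod_cast hκ

/-- The bound on the failure probability for a single verifier is eventually at most `2 (912 / 1000) ^ t`. -/
lemma eventually_failure_le (hn : (fun κ : ℕ => (κ : ℝ)) =O[atTop] fun κ => (n κ : ℝ))
    (ht : (fun κ : ℕ => (t κ : ℝ)) =Θ[atTop] fun κ => √(n κ : ℝ)) :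
    ∀ᶠ κ in atTop, (6 / 5 * (3 / 4 + (t κ : ℝ) / n κ) : ℝ) ^ t κ +
      2 ^ (n κ / 4 + t κ) / 2 ^ (n κ / 2) ≤ 2 * (912 / 1000 : ℝ) ^ t κ := by
  filter_upwards [(tendsto_div_zero hn ht).eventually_le_const (show (0 : ℝ) < 1 / 100 by norm_num),
    (tendsto_natCast_of_isBigO hn).eventually_ge_atTop 100] with κ h1 h2
  have h3 : (6 / 5 * (3 / 4 + (t κ : ℝ) / n κ) : ℝ) ^ t κ ≤ (912 / 1000 : ℝ) ^ t κ :=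
    pow_le_pow_left₀ (by positivity) (by linarith) _
  have h4 : (2 : ℝ) ^ (n κ / 4 + t κ) / 2 ^ (n κ / 2) ≤ (912 / 1000 : ℝ) ^ t κ := by
    rw [div_le_iff₀ (by linarith)] at h1
    have h5 : n κ / 4 + t κ + t κ ≤ n κ / 2 := by
      have h6 : (100 * t κ : ℝ) ≤ n κ := by linarith
      have h7 : 100 * t κ ≤ n κ := by exact_mod_cast h6
      have h8 : 100 ≤ n κ := by exact_mod_cast h2
      omega
    have h9 : (2 : ℝ) ^ (n κ / 4 + t κ) * 2 ^ t κ ≤ 2 ^ (n κ / 2) := by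
      rw [← pow_add]
      exact pow_le_pow_right₀ one_le_two h5
    have h10 : (1 : ℝ) ≤ (912 / 1000) ^ t κ * 2 ^ t κ := by
      rw [← mul_pow]
      exact one_le_pow₀ (by norm_num)
    rw [div_le_iff₀ (by positivity)]
    calc (2 : ℝ) ^ (n κ / 4 + t κ) ≤ 2 ^ (n κ / 4 + t κ) * ((912 / 1000) ^ t κ * 2 ^ t κ) :=
          le_mul_of_one_le_right (by positivity) h10
      _ = (912 / 1000) ^ t κ * (2 ^ (n κ / 4 + t κ) * 2 ^ t κ) := by ring
      _ ≤ _ := by gcongr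
  linarith

theorem negligible_setupProb_not_good
    (hN : ∃ p : Polynomial ℕ, ∀ κ, N κ ≤ p.eval κ)
    (hn_even : ∀ κ, Even (n κ))
    (hn : (fun κ : ℕ => (κ : ℝ)) =O[atTop] fun κ => (n κ : ℝ))
    (ht : (fun κ : ℕ => (t κ : ℝ)) =Θ[atTop] fun κ => √(n κ : ℝ)) :
    Negligible fun κ => setupProb fun k : MSK (N κ) (n κ) (t κ) => ¬ k.Good := by
  obtain ⟨p, hp⟩ := hN
  have hlog : 0 < -Real.log (912 / 1000) :=
    neg_pos.2 (Real.log_neg (by norm_num) (by norm_num))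
  refine (((negligible_exp_neg_mul hn ht hlog).polynomial_mul p).const_mul 4).of_le
    (Eventually.of_forall fun κ => setupProb_nonneg _) ?_
  filter_upwards [eventually_failure_le hn ht, eventually_pos_of_isBigO hn] with κ h1 h2
  refine (setupProb_not_good_le (hn_even κ) h2).trans ?_
  have h3 : Real.exp (-(-Real.log (912 / 1000) * t κ)) = (912 / 1000 : ℝ) ^ t κ := by
    rw [neg_mul, neg_neg, mul_comm, Real.exp_nat_mul, Real.exp_log (by norm_num)]
  have h4 : (N κ : ℝ) ≤ p.eval κ := by exact_mod_cast hp κ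
  rw [h3]
  calc _ ≤ 2 * (N κ : ℝ) * (2 * (912 / 1000 : ℝ) ^ t κ) := by gcongr
    _ = 4 * ((N κ : ℝ) * (912 / 1000 : ℝ) ^ t κ) := by ring
    _ ≤ _ := by gcongr

theorem negligible_setupProb_not_good_or_lt
    (hN : ∃ p : Polynomial ℕ, ∀ κ, N κ ≤ p.eval κ)
    (hn_even : ∀ κ, Even (n κ))
    (hn : (fun κ : ℕ => (κ : ℝ)) =O[atTop] fun κ => (n κ : ℝ))
    (ht : (fun κ : ℕ => (t κ : ℝ)) =Θ[atTop] fun κ => √(n κ : ℝ)) {ρ : ℝ} (hρ : 0 < ρ) :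
    Negligible fun κ => setupProb fun k : MSK (N κ) (n κ) (t κ) =>
      ¬ (k.Good ∧ (Module.finrank (ZMod 2) ↥(k.A ⊓ perp k.A) : ℝ) ≤ ρ * t κ) := by
  refine ((negligible_setupProb_not_good hN hn_even hn ht).add
    ((negligible_exp_neg_mul hn ht (mul_pos (Real.log_pos one_lt_two) hρ)).const_mul 8)).of_le
    (Eventually.of_forall fun κ => setupProb_nonneg _) ?_
  filter_upwards [eventually_pos_of_isBigO hn] with κ h1
  have h2 := setupProb_lt_finrank_inf_perp_le (N := N κ) (t := t κ) (hn_even κ) h1 (ρ * t κ)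
  rw [Real.rpow_def_of_pos two_pos, mul_neg, ← mul_assoc] at h2
  refine le_trans ?_ (add_le_add_right h2 _)
  refine le_trans (setupProb_mono fun k _ h => ?_) (setupProb_or_le _ _)
  rcases not_and_or.1 h with h | h
  · exact Or.inl h
  · exact Or.inr (not_le.1 h)

/-- When `dim (A ∩ A^⊥) ≤ ρ t`, the advantage of a circuit of size `q` on a good key is at most `q`
times an exponential in `-t`. -/
lemma advantage_le_exp {G : Finset Gate} {N n t : ℕ} {k : MSK N n t} (hk : k.Valid) (hg : k.Good)
    {ρ : ℝ} (hr : (Module.finrank (ZMod 2) ↥(k.A ⊓ perp k.A) : ℝ) ≤ ρ * t)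
    (c : Circuit G (QueryReg N n t)) {q : ℕ} (hq : c.size ≤ q) :
    advantage k c ≤ 8 * (q * Real.exp (-(Real.log 2 * (1 / 4 - ρ) / 2 * t))) := by
  refine (advantage_le hk hg c).trans ?_
  have h1 : (c.steps.length : ℝ) ≤ q := by
    exact_mod_cast (Nat.le_add_left _ _).trans hq
  have h2 : √(2 * 2 ^ ((Module.finrank (ZMod 2) ↥(k.A ⊓ perp k.A) : ℝ) - t / 4)) ≤
      2 * Real.exp (-(Real.log 2 * (1 / 4 - ρ) / 2 * t)) := by
    refine Real.sqrt_le_iff.2 ⟨by positivity, ?_⟩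
    have h3 : (2 : ℝ) ^ ((Module.finrank (ZMod 2) ↥(k.A ⊓ perp k.A) : ℝ) - t / 4) ≤
        Real.exp (-(Real.log 2 * (1 / 4 - ρ) / 2 * t)) ^ 2 := by
      rw [← Real.exp_nat_mul, Real.rpow_def_of_pos two_pos]
      refine Real.exp_le_exp.2 ?_
      have := mul_le_mul_of_nonneg_left hr (Real.log_pos one_lt_two).le
      push_cast
      linarith
    have h4 : 0 ≤ Real.exp (-(Real.log 2 * (1 / 4 - ρ) / 2 * t)) ^ 2 := by positivity
    rw [mul_pow]
    linarith
  calc _ ≤ 4 * (q : ℝ) * (2 * Real.exp (-(Real.log 2 * (1 / 4 - ρ) / 2 * t))) := by gcongr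
    _ = _ := by ring

end Asymptotic

end FranchisedMoney

theorem mainTheorem3
    (N n t : ℕ → ℕ)
    (hN : ∃ p : Polynomial ℕ, ∀ κ, N κ ≤ p.eval κ)
    (hn_even : ∀ κ, Even (n κ))
    (hn : (fun κ : ℕ => (κ : ℝ)) =O[Filter.atTop] fun κ => (n κ : ℝ))
    (ht : (fun κ : ℕ => (t κ : ℝ)) =Θ[Filter.atTop] fun κ => Real.sqrt (n κ : ℝ)) :
    FranchisedMoney.Negligible (fun κ =>
        1 - FranchisedMoney.setupProb
          (fun k : FranchisedMoney.MSK (N κ) (n κ) (t κ) => k.Good)) ∧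
    (∀ ρ : ℝ, 0 < ρ →
      FranchisedMoney.Negligible (fun κ =>
        1 - FranchisedMoney.setupProb
          (fun k : FranchisedMoney.MSK (N κ) (n κ) (t κ) =>
            k.Good ∧
              (Module.finrank (ZMod 2) ↥(k.A ⊓ FranchisedMoney.perp k.A) : ℝ) ≤ ρ * t κ))) ∧
    ∀ (G : Finset FranchisedMoney.Gate) (𝒜 : FranchisedMoney.Adversary G N n t),
      𝒜.PolyTime →
        (∀ ρ : ℝ, 0 < ρ → ρ < 1 / 4 → ∀ c : ℝ, 0 < c →
          ∀ᶠ κ in Filter.atTop, ∀ k : FranchisedMoney.MSK (N κ) (n κ) (t κ),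
            k.Valid → k.Good →
            (Module.finrank (ZMod 2) ↥(k.A ⊓ FranchisedMoney.perp k.A) : ℝ) ≤ ρ * t κ →
              FranchisedMoney.advantage k (𝒜 κ k) ≤
                (2 : ℝ) ^ (-(c * (n κ : ℝ) ^ (1 / 3 : ℝ)))) ∧
        FranchisedMoney.Negligible (fun κ =>
          FranchisedMoney.setupExp
            (fun k : FranchisedMoney.MSK (N κ) (n κ) (t κ) =>
              FranchisedMoney.advantage k (𝒜 κ k))) := by
  open FranchisedMoney in
  have hcompl : ∀ E : ∀ κ, MSK (N κ) (n κ) (t κ) → Prop,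
      Negligible (fun κ => setupProb fun k => ¬ E κ k) →
        Negligible (fun κ => 1 - setupProb (E κ)) := fun E h => by
    refine SuperpolynomialDecay.congr' h ?_
    filter_upwards [eventually_pos_of_isBigO hn] with κ hκ
    exact (one_sub_setupProb (setupSupport_card_pos (hn_even κ) hκ) _).symm
  refine ⟨hcompl _ (negligible_setupProb_not_good hN hn_even hn ht), fun ρ hρ =>
    hcompl _ (negligible_setupProb_not_good_or_lt hN hn_even hn ht hρ), fun G 𝒜 hA => ?_⟩
  obtain ⟨p, hp⟩ := hA
  refine ⟨fun ρ hρ hρ4 c hc => ?_, ?_⟩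
  · -- Half of the exponent absorbs the polynomial, the other half exceeds `c n ^ (1 / 3)`.
    set b := Real.log 2 * (1 / 4 - ρ) / 2 with hb
    have hb0 : 0 < b := by
      have : 0 < 1 / 4 - ρ := by linarith
      positivity
    have h1 := (((negligible_exp_neg_mul hn ht (half_pos hb0)).polynomial_mul p).const_mul
      8).tendsto_zero
    filter_upwards [h1.eventually_le_const one_pos,
      eventually_rpow_third_le hn ht (Real.log 2 * c / (b / 2))]
      with κ h2 h3 k hk hg hr
    refine (advantage_le_exp hk hg hr _ (hp κ k (mem_setupSupport.2 hk))).trans ?_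
    have h4 : Real.exp (-(b * t κ)) = Real.exp (-(b / 2 * t κ)) * Real.exp (-(b / 2 * t κ)) := by
      rw [← Real.exp_add]
      ring_nf
    have h5 : Real.exp (-(b / 2 * t κ)) ≤ 2 ^ (-(c * (n κ : ℝ) ^ (1 / 3 : ℝ))) := by
      rw [Real.rpow_def_of_pos two_pos, Real.exp_le_exp, mul_neg, neg_le_neg_iff, ← mul_assoc]
      rw [div_mul_eq_mul_div, div_le_iff₀ (half_pos hb0)] at h3
      linarith
    rw [← hb, h4]
    calc _ = 8 * (((p.eval κ : ℕ) : ℝ) * Real.exp (-(b / 2 * t κ))) *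
          Real.exp (-(b / 2 * t κ)) := by ring
      _ ≤ 1 * Real.exp (-(b / 2 * t κ)) := by gcongr
      _ ≤ _ := by rwa [one_mul]
  · have h8 : (0 : ℝ) < 1 / 8 := by norm_num
    have hb0 : 0 < Real.log 2 * (1 / 4 - 1 / 8) / 2 := by
      have : (0 : ℝ) < 1 / 4 - 1 / 8 := by norm_num
      positivity
    refine ((negligible_setupProb_not_good_or_lt hN hn_even hn ht h8).add
      (((negligible_exp_neg_mul hn ht hb0).polynomial_mul p).const_mul 8)).of_le
      (Eventually.of_forall fun κ => setupExp_nonneg fun k _ => advantage_nonneg _ _) ?_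
    filter_upwards [eventually_pos_of_isBigO hn] with κ hκ
    rw [setupProb, ← setupExp_const (setupSupport_card_pos (N := N κ) (t := t κ) (hn_even κ) hκ)
      (8 * (_ * _)), ← setupExp_add]
    refine setupExp_mono fun k hk => ?_
    by_cases h : k.Good ∧ (Module.finrank (ZMod 2) ↥(k.A ⊓ perp k.A) : ℝ) ≤ 1 / 8 * t κ
    · rw [if_neg (not_not.2 h), zero_add]
      exact advantage_le_exp hk h.1 h.2 _ (hp κ k (mem_setupSupport.2 hk))
    · rw [if_pos h]
      exact (advantage_le_one _ _).trans (le_add_of_nonneg_right (by positivity))
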